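/- Let $M$ be a smooth manifold (finite-dimensional, without boundary, Hausdorff, second countable; not necessarily connected) and let $\beta\colon M\to \mathrm{U}(1)\subset\mathbb{C}$ be smooth. For $p\in M$ and $c\in\pi_1(M,p)$ put $$F_{\beta,p}(c)=\frac{1}{2\pi}\int_\sigma \frac{1}{i\beta}\,d\beta ,$$ where $\sigma$ is any $C^1$ loop at $p$ representing $c$. Such a loop exists, the value does not depend on its choice, and $F_{\beta,p}(c)\in\mathbb{Z}$. Let $[F_{\beta,p}]\colon\pi_1(M,p)\to\mathbb{Z}_2$ be $F_{\beta,p}$ modulo $2$. Then the following are equivalent: 1. there is a smooth $b\colon M\to\mathrm{U}(1)$ such that $\beta=b^2$; 2. $[F_{\beta,p}]=0$ for all $p\in M$; 3. $[F_{\beta,p_k}](\sigma_k)=0$ for all members of a set of loops $\sigma_k$ (based at points $p_k\in M$) whose classes generate $H_1(M,\mathbb{Z})$; 4. $[F_{\beta,p_k}](\sigma_k)=0$ for all members of a set of loops $\sigma_k$ (based at points $p_k\in M$) whose classes generate $H_1(M,\mathbb{Z}_2)$; 5. the pullback $\beta^*\colon H^1(\mathrm{U}(1),\mathbb{Z}_2)\to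 H^1(M,\mathbb{Z}_2)$ in singular cohomology is the zero map. In 3 and 4, "a set of loops" may be read either as "some set of loops with this property" or as "every set of loops with this property": the two readings of each condition are equivalent to each other and to the remaining conditions. -/

import Mathlib

open CategoryTheory Manifold
open scoped ContDiff

universe u

noncomputable section

namespace CircleRoot

/-! ### Line integrals of `dβ / (iβ)` and the winding functional -/

section Winding

variable {n : ℕ} {M : Type u} [TopologicalSpace M] [ChartedSpace (EuclideanSpace ℝ (Fin n)) M]

/-- The differential `dβ_x : T_x M → ℂ` of a map `β : M → U(1) ⊆ ℂ`. -/
def circleDifferential (β : M → Circle) (x : M) : TangentSpace (𝓡 n) x →L[ℝ] ℂ :=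
  mfderiv (𝓡 n) 𝓘(ℝ, ℂ) (fun y : M => (β y : ℂ)) x

/-- The real one-form `(1 / (i β)) dβ` of a map `β : M → U(1) ⊆ ℂ`, evaluated at the tangent vector
`v` at `x`. For differentiable `β` the complex number below is real because `|β| = 1`; taking the
real part only changes its type. -/
def angularForm (β : M → Circle) (x : M) (v : TangentSpace (𝓡 n) x) : ℝ :=
  ((Complex.I * (β x : ℂ))⁻¹ * circleDifferential β x v).re

/-- The line integral `∫_σ (1 / (i β)) dβ` along a path `σ : [0, 1] → M`
(meaningful when `σ` is `C¹`). -/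
def angularIntegral (β : M → Circle) {p q : M} (σ : Path p q) : ℝ :=
  ∫ t in (0 : ℝ)..1,
    angularForm (n := n) β (σ.extend t) (mfderiv 𝓘(ℝ, ℝ) (𝓡 n) σ.extend t (1 : ℝ))

/-- A path `[0, 1] → M` that is continuously differentiable up to the endpoints. -/
def IsC1Path (n : ℕ) {M : Type u} [TopologicalSpace M] [ChartedSpace (EuclideanSpace ℝ (Fin n)) M]
    {p q : M} (σ : Path p q) : Prop :=
  ContMDiffOn 𝓘(ℝ, ℝ) (𝓡 n) 1 σ.extend (Set.Icc 0 1)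

open Classical in
/-- The functional `F_{β,p} : π₁(M, p) → ℝ`, `c ↦ (1 / 2π) ∫_σ (1 / (i β)) dβ`, where `σ` is a
`C¹` loop in the class `c`. -/
def windingFunctional (n : ℕ) {M : Type u} [TopologicalSpace M]
    [ChartedSpace (EuclideanSpace ℝ (Fin n)) M] (β : M → Circle) (p : M)
    (c : FundamentalGroup M p) : ℝ :=
  if h : ∃ σ : Path p p, IsC1Path n σ ∧ FundamentalGroup.fromPath ⟦σ⟧ = c then
    1 / (2 * Real.pi) * angularIntegral (n := n) β h.choose
  else 0

/-- The functional `[F_{β,p}] : π₁(M, p) → ℤ₂`: the integer `F_{β,p}(c)` modulo `2`. -/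
def windingModTwo (n : ℕ) {M : Type u} [TopologicalSpace M]
    [ChartedSpace (EuclideanSpace ℝ (Fin n)) M] (β : M → Circle) (p : M)
    (c : FundamentalGroup M p) : ZMod 2 :=
  ((⌊windingFunctional n β p c⌋ : ℤ) : ZMod 2)

end Winding

/-! ### Singular homology and the class of a loop -/

section Homology

/-- The singular chain complex `C_•(X; R)`. -/
abbrev singularChains (R : Type) [CommRing R] (X : TopCat.{u}) : ChainComplex (ModuleCat.{u} R) ℕ :=
  ((AlgebraicTopology.singularChainComplexFunctor (ModuleCat.{u} R)).obj
    (ModuleCat.of R (ULift.{u} R))).obj X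

/-- The chain map `C_•(X; R) → C_•(Y; R)` induced by a continuous map. -/
abbrev singularChainsMap (R : Type) [CommRing R] {X Y : TopCat.{u}} (f : X ⟶ Y) :
    singularChains R X ⟶ singularChains R Y :=
  ((AlgebraicTopology.singularChainComplexFunctor (ModuleCat.{u} R)).obj
    (ModuleCat.of R (ULift.{u} R))).map f

/-- Singular homology `H_k(X; R)`. -/
abbrev singularHomology (R : Type) [CommRing R] (X : TopCat.{u}) (k : ℕ) : ModuleCat.{u} R :=
  ((AlgebraicTopology.singularHomologyFunctor (ModuleCat.{u} R) k).obj
    (ModuleCat.of R (ULift.{u} R))).obj X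

variable {X : Type u} [TopologicalSpace X]

open Simplicial in
/-- A path, as a singular `1`-simplex: its precomposition with `Δ¹ ≃ [0, 1]`. -/
def pathSimplex {p q : X} (σ : Path p q) : (TopCat.toSSet.obj (TopCat.of X)) _⦋1⦌ :=
  ((TopCat.of X).toSSetObjEquiv (Opposite.op ⦋1⦌)).symm
    (σ.toContinuousMap.comp (stdSimplexHomeomorphUnitInterval : C(stdSimplex ℝ (Fin 2), unitInterval)))

/-- The map `R → C₁(X; R)` whose value at `1` is the chain given by a path. -/
def pathChain (R : Type) [CommRing R] {p q : X} (σ : Path p q) :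
    ModuleCat.of R (ULift.{u} R) ⟶ (singularChains R (TopCat.of X)).X 1 :=
  (TopCat.toSSet.obj (TopCat.of X)).ιChainComplex (pathSimplex σ)

theorem pathSimplex_δ {p : X} (σ : Path p p) :
    (TopCat.toSSet.obj (TopCat.of X)).δ 0 (pathSimplex σ) =
      (TopCat.toSSet.obj (TopCat.of X)).δ 1 (pathSimplex σ) := by
  have h0 : stdSimplexHomeomorphUnitInterval
      (stdSimplex.map (Fin.succAbove (0 : Fin 2)) (default : stdSimplex ℝ (Fin 1))) = 1 := by
    rw [Subsingleton.elim (default : stdSimplex ℝ (Fin 1)) (stdSimplex.vertex 0),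
      stdSimplex.map_vertex]
    rfl
  have h1 : stdSimplexHomeomorphUnitInterval
      (stdSimplex.map (Fin.succAbove (1 : Fin 2)) (default : stdSimplex ℝ (Fin 1))) = 0 := by
    rw [Subsingleton.elim (default : stdSimplex ℝ (Fin 1)) (stdSimplex.vertex 0),
      stdSimplex.map_vertex]
    rfl
  apply TopCat.toSSetObj₀Equiv.injective
  change σ (stdSimplexHomeomorphUnitInterval (stdSimplex.map (Fin.succAbove (0 : Fin 2))
      (default : stdSimplex ℝ (Fin 1)))) =
    σ (stdSimplexHomeomorphUnitInterval (stdSimplex.map (Fin.succAbove (1 : Fin 2))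
      (default : stdSimplex ℝ (Fin 1))))
  rw [h0, h1, σ.target, σ.source]

theorem pathChain_d (R : Type) [CommRing R] {p : X} (σ : Path p p) :
    pathChain R σ ≫ (singularChains R (TopCat.of X)).d 1 0 = 0 := by
  have h := (TopCat.toSSet.obj (TopCat.of X)).ιChainComplex_d
    (R := ModuleCat.of R (ULift.{u} R)) (pathSimplex σ)
  refine h.trans ?_
  rw [Fin.sum_univ_two, pathSimplex_δ]
  simp
  rfl

/-- The homology class in `H₁(X; R)` of a loop in `X`. -/
def loopClass (R : Type) [CommRing R] {p : X} (σ : Path p p) :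
    singularHomology R (TopCat.of X) 1 :=
  ((singularChains R (TopCat.of X)).liftCycles (pathChain R σ) 0 (by simp) (pathChain_d R σ) ≫
    (singularChains R (TopCat.of X)).homologyπ 1).hom (ULift.up 1)

/-- The classes of the loops in `S` generate `H₁(X; R)` as an `R`-module. -/
def GeneratesH1 (R : Type) [CommRing R] (S : Set (Σ p : X, Path p p)) : Prop :=
  Submodule.span R ((fun σ : Σ p : X, Path p p => loopClass R σ.2) '' S) = ⊤

end Homology

/-! ### Singular cohomology -/

section Cohomology

/-- The cochain complex `C^•(X; A) = Hom_ℤ(C_•(X; ℤ), A)`. -/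
abbrev singularCochains (A : ModuleCat.{u} ℤ) (X : TopCat.{u}) : CochainComplex (ModuleCat.{u} ℤ) ℕ :=
  (singularChains ℤ X).linearYonedaObj ℤ A

/-- The cochain map `C^•(Y; A) → C^•(X; A)`, precomposition with `C_•(X; ℤ) → C_•(Y; ℤ)`. -/
def singularCochainsMap (A : ModuleCat.{u} ℤ) {X Y : TopCat.{u}} (f : X ⟶ Y) :
    singularCochains A Y ⟶ singularCochains A X where
  f i := ((linearYoneda ℤ (ModuleCat.{u} ℤ)).obj A).map ((singularChainsMap ℤ f).f i).op
  comm' i j _ := by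
    have h := congrArg (fun g => ((linearYoneda ℤ (ModuleCat.{u} ℤ)).obj A).map g.op)
      ((singularChainsMap ℤ f).comm j i)
    simp only [op_comp, Functor.map_comp] at h
    exact h.symm

/-- Singular cohomology `H^k(X; A)`. -/
abbrev singularCohomology (A : ModuleCat.{u} ℤ) (X : TopCat.{u}) (k : ℕ) : ModuleCat.{u} ℤ :=
  (singularCochains A X).homology k

/-- The pullback `f^* : H^k(Y; A) → H^k(X; A)`. -/
def cohomologyPullback (A : ModuleCat.{u} ℤ) {X Y : TopCat.{u}} (f : X ⟶ Y) (k : ℕ) :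
    singularCohomology A Y k ⟶ singularCohomology A X k :=
  HomologicalComplex.homologyMap (singularCochainsMap A f) k

/-- A continuous map `X → U(1)` as a morphism of `TopCat` (the circle is lifted to the universe
of `X`). -/
def toCircleHom {X : Type u} [TopologicalSpace X] (f : C(X, Circle)) :
    TopCat.of X ⟶ TopCat.of (ULift.{u} Circle) :=
  TopCat.ofHom ⟨fun x => ULift.up (f x), by fun_prop⟩

end Cohomology

end CircleRoot

end

noncomputable section

/-! ### Additive invariants of paths -/

section PathCocycle

open unitInterval

namespace CircleRoot

/-! All conditions are compared with a single one: the winding number of `β` around every continuous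
loop is even. Lifting through `Circle.exp` gives each continuous path an angle change. It equals the
line integral on `C¹` paths (`angularIntegral_eq_angleChange`), and every path is homotopic to a
smooth one (`isSmoothable`), so `F_{β,p}` is well defined and integral.

The common tool is `PathCocycle`: a function on paths, additive on the edges of affine triangles. It
is automatically homotopy invariant, and it is a difference of end point values as soon as it
vanishes on loops (`exists_potential`). Angle change, winding number and the class of a curve modulo
boundaries are all of this kind.

Square roots: squaring doubles winding numbers. Conversely, if they are all even, the parity of the
winding cocycle has a potential `u` with values in `ℤ₂`, and `exp(i(arg β / 2 + π u))` is a root,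
the sign `u` undoing the jumps of `arg`.

Homology: path cocycles induce maps on `H₁` (`onHomology`), so parity may be tested on generators;
all loops together generate `H₁` (`generatesH1_univ`).

Cohomology: a pulled back 1-cocycle is a coboundary iff it vanishes on loops. On the circle, a
cocycle with 2-torsion values kills loops of even winding number, while the winding cocycle modulo 2
detects the odd ones. -/

/-- The affine segment from `a` to `b`, mapped by `F`. -/
def mapSegment {X : Type*} [TopologicalSpace X] {E : Type*} [AddCommGroup E] [Module ℝ E]
    [TopologicalSpace E] [ContinuousAdd E] [ContinuousSMul ℝ E] (F : C(E, X)) (a b : E) : C(I, X) :=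
  ⟨fun t => F ((1 - (t : ℝ)) • a + (t : ℝ) • b), by fun_prop⟩

@[simp]
theorem mapSegment_zero {X : Type*} [TopologicalSpace X] {E : Type*} [AddCommGroup E] [Module ℝ E]
    [TopologicalSpace E] [ContinuousAdd E] [ContinuousSMul ℝ E] (F : C(E, X)) (a b : E) :
    mapSegment F a b 0 = F a := by
  simp [mapSegment]

@[simp]
theorem mapSegment_one {X : Type*} [TopologicalSpace X] {E : Type*} [AddCommGroup E] [Module ℝ E]
    [TopologicalSpace E] [ContinuousAdd E] [ContinuousSMul ℝ E] (F : C(E, X)) (a b : E) :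
    mapSegment F a b 1 = F b := by
  simp [mapSegment]

/-- A function on paths that is additive along the boundary of every triangle. -/
structure PathCocycle (X : Type*) [TopologicalSpace X] (A : Type*) [AddCommGroup A] where
  /-- The underlying function. -/
  toFun : C(I, X) → A
  triangle (F : C(ℝ × ℝ, X)) (a b c : ℝ × ℝ) :
    toFun (mapSegment F a b) + toFun (mapSegment F b c) = toFun (mapSegment F a c)

namespace PathCocycle

variable {X : Type*} [TopologicalSpace X] {A : Type*} [AddCommGroup A] (Φ : PathCocycle X A)

theorem const (x : X) : Φ.toFun (ContinuousMap.const I x) = 0 := by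
  have h := Φ.triangle (ContinuousMap.const _ x) 0 0 0
  have e : mapSegment (ContinuousMap.const (ℝ × ℝ) x) 0 0 = ContinuousMap.const I x := rfl
  rw [e] at h
  simpa using h

/-- Degenerate triangles are allowed, so the cocycle condition contains additivity under subdivision
of a path, and behaviour under reversal. -/
theorem triangle_real (F : C(ℝ, X)) (a b c : ℝ) :
    Φ.toFun (mapSegment F a b) + Φ.toFun (mapSegment F b c) = Φ.toFun (mapSegment F a c) :=
  Φ.triangle (F.comp ContinuousMap.fst) (a, 0) (b, 0) (c, 0)

theorem trans {x y z : X} (γ : Path x y) (γ' : Path y z) :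
    Φ.toFun (γ.trans γ').toContinuousMap =
      Φ.toFun γ.toContinuousMap + Φ.toFun γ'.toContinuousMap := by
  have h := Φ.triangle_real (γ.trans γ').extend 0 (1 / 2) 1
  have e1 : mapSegment (γ.trans γ').extend 0 (1 / 2) = γ.toContinuousMap := by
    ext t
    have h0 := t.2.1
    have h1 := t.2.2
    change (γ.trans γ').extend _ = γ t
    rw [γ.extend_trans_of_le_half _ (by simp only [smul_eq_mul]; linarith), ← γ.extend_extends']
    congr 1
    simp only [smul_eq_mul]
    ring
  have e2 : mapSegment (γ.trans γ').extend (1 / 2) 1 = γ'.toContinuousMap := by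
    ext t
    have h0 := t.2.1
    have h1 := t.2.2
    change (γ.trans γ').extend _ = γ' t
    rw [γ.extend_trans_of_half_le _ (by simp only [smul_eq_mul]; linarith), ← γ'.extend_extends']
    congr 1
    simp only [smul_eq_mul]
    ring
  have e3 : mapSegment (γ.trans γ').extend 0 1 = (γ.trans γ').toContinuousMap := by
    ext t
    change (γ.trans γ').extend _ = (γ.trans γ') t
    rw [← Path.extend_extends']
    congr 1
    simp
  rw [e1, e2, e3] at h
  exact h.symm

theorem symm {x y : X} (γ : Path x y) :
    Φ.toFun γ.symm.toContinuousMap = -Φ.toFun γ.toContinuousMap := by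
  have h := Φ.triangle_real γ.extend 0 1 0
  have e1 : mapSegment γ.extend 0 1 = γ.toContinuousMap := by
    ext t
    change γ.extend _ = γ t
    rw [← Path.extend_extends']
    congr 1
    simp
  have e2 : mapSegment γ.extend 1 0 = γ.symm.toContinuousMap := by
    ext t
    change γ.extend _ = γ.symm t
    rw [← Path.extend_extends', Path.extend_symm_apply]
    congr 1
    simp
  have e3 : mapSegment γ.extend 0 0 = ContinuousMap.const I x := by
    ext t
    change γ.extend _ = x
    simp
  rw [e1, e2, e3, Φ.const] at h
  exact eq_neg_of_add_eq_zero_right h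

/-- The square of the homotopy is cut along its diagonal: both triangles share the edge from `(0,
0)` to `(1, 1)`, and each has one constant side. -/
theorem homotopic {x y : X} {γ γ' : Path x y} (h : γ.Homotopic γ') :
    Φ.toFun γ.toContinuousMap = Φ.toFun γ'.toContinuousMap := by
  obtain ⟨H⟩ := h
  -- Clamping extends the homotopy from the square to the whole plane, where the triangles live.
  let p : ℝ → I := Set.projIcc 0 1 zero_le_one
  have hp : Continuous p := continuous_projIcc
  have hpI (t : I) : p t = t := Set.projIcc_val _ _
  have hp0 : p 0 = 0 := hpI 0
  have hp1 : p 1 = 1 := hpI 1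
  let F : C(ℝ × ℝ, X) := ⟨fun z => H (p z.1, p z.2), by fun_prop⟩
  have e1 : mapSegment F (0, 0) (0, 1) = γ.toContinuousMap := by
    ext t
    change H (p _, p _) = γ t
    simp [hpI, hp0]
  have e2 : mapSegment F (0, 1) (1, 1) = ContinuousMap.const I y := by
    ext t
    change H (p _, p _) = y
    simp [hpI, hp1]
  have e3 : mapSegment F (0, 0) (1, 0) = ContinuousMap.const I x := by
    ext t
    change H (p _, p _) = x
    simp [hpI, hp0]
  have e4 : mapSegment F (1, 0) (1, 1) = γ'.toContinuousMap := by
    ext t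
    change H (p _, p _) = γ' t
    simp [hpI, hp1]
  have h1 := Φ.triangle F (0, 0) (0, 1) (1, 1)
  have h2 := Φ.triangle F (0, 0) (1, 0) (1, 1)
  rw [e1, e2, Φ.const, add_zero] at h1
  rw [e3, e4, Φ.const, zero_add] at h2
  rw [h1, h2]

/-- Composition of a cocycle with a homomorphism of the groups of values. -/
def map {B : Type*} [AddCommGroup B] (φ : A →+ B) : PathCocycle X B where
  toFun γ := φ (Φ.toFun γ)
  triangle F a b c := by rw [← map_add, Φ.triangle]

/-- The pullback of a cocycle along a continuous map. -/
def pullback {Y : Type*} [TopologicalSpace Y] (f : C(Y, X)) : PathCocycle Y A where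
  toFun γ := Φ.toFun (f.comp γ)
  triangle F a b c := Φ.triangle (f.comp F) a b c

/-- A cocycle that vanishes on all loops is a difference of values of a function. -/
theorem exists_potential (h : ∀ (x : X) (γ : Path x x), Φ.toFun γ.toContinuousMap = 0) :
    ∃ u : X → A, ∀ (x y : X) (γ : Path x y), Φ.toFun γ.toContinuousMap = u y - u x := by
  classical
  -- A base point in each path component; the potential at `x` is the value on a chosen path from it
  -- to `x`.
  let r : X → X := fun x => (Quotient.mk (pathSetoid X) x).out
  have hr (x : X) : Joined (r x) x := Quotient.exact (s := pathSetoid X) (Quotient.out_eq _)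
  have hrr {x y : X} (γ : Path x y) : r x = r y := by
    simp only [r]
    rw [Quotient.sound (s := pathSetoid X) (show Joined x y from ⟨γ⟩)]
  refine ⟨fun x => Φ.toFun (hr x).somePath.toContinuousMap, fun x y γ => ?_⟩
  have h1 := h _ (((hr x).somePath.trans γ).trans ((hr y).somePath.cast (hrr γ) rfl).symm)
  rw [Φ.trans, Φ.symm, Φ.trans] at h1
  have e : ((hr y).somePath.cast (hrr γ) rfl).toContinuousMap = (hr y).somePath.toContinuousMap :=
    rfl
  rw [e] at h1
  rw [add_neg_eq_zero] at h1
  simp only [← h1]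
  abel

end PathCocycle

end CircleRoot

end PathCocycle

/-! ### The change of angle of a circle-valued map along a path -/

section AngleChange

open unitInterval

namespace CircleRoot

variable {X : Type*} [TopologicalSpace X]

theorem exists_exp_lift {Y : Type*} [TopologicalSpace Y] [SimplyConnectedSpace Y]
    [LocallyPathConnectedSpace Y] (g : C(Y, Circle)) :
    ∃ θ : C(Y, ℝ), ∀ y, Circle.exp (θ y) = g y := by
  have y₀ : Y := Classical.arbitrary Y
  obtain ⟨F, ⟨-, hF⟩, -⟩ := Circle.isCoveringMap_exp.existsUnique_continuousMap_lifts g y₀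
    (Complex.arg (g y₀)) (Circle.exp_arg _)
  exact ⟨F, congrFun hF⟩

theorem exists_exp_lift_interval (g : C(I, Circle)) :
    ∃ θ : C(I, ℝ), ∀ t, Circle.exp (θ t) = g t := by
  obtain ⟨θ, hθ⟩ := exists_exp_lift (g.comp ⟨Set.projIcc (0 : ℝ) 1 zero_le_one, continuous_projIcc⟩)
  exact ⟨θ.comp ⟨Subtype.val, continuous_subtype_val⟩, fun t => by simp [hθ]⟩

/-- Two lifts differ by `2π` times a continuous, hence constant, integer function. -/
theorem sub_eq_sub_of_exp_eq {Y : Type*} [TopologicalSpace Y] [PreconnectedSpace Y] {θ θ' : Y → ℝ}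
    (hθ : Continuous θ) (hθ' : Continuous θ') (h : ∀ y, Circle.exp (θ y) = Circle.exp (θ' y))
    (a b : Y) : θ b - θ a = θ' b - θ' a := by
  choose m hm using fun y => Circle.exp_eq_exp.1 (h y)
  have hpi := Real.pi_pos
  have hc : Continuous m := by
    have h1 : Continuous fun y => ((m y : ℤ) : ℝ) := by
      have : (fun y => ((m y : ℤ) : ℝ)) = fun y => (θ y - θ' y) / (2 * Real.pi) := by
        funext y
        rw [hm y]
        field_simp
        ring
      rw [this]
      fun_prop
    exact Int.isClosedEmbedding_coe_real.isEmbedding.continuous_iff.2 h1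
  have := PreconnectedSpace.constant ‹_› hc (x := a) (y := b)
  rw [hm a, hm b, this]
  ring

/-- The total change `θ(1) - θ(0)` of the angle of `f` along a path `γ`,
where `f (γ t) = exp (i θ(t))`. -/
def angleChange (f : C(X, Circle)) (γ : C(I, X)) : ℝ :=
  (exists_exp_lift_interval (f.comp γ)).choose 1 - (exists_exp_lift_interval (f.comp γ)).choose 0

theorem angleChange_eq (f : C(X, Circle)) (γ : C(I, X)) {θ : I → ℝ} (hθ : Continuous θ)
    (h : ∀ t, Circle.exp (θ t) = f (γ t)) : angleChange f γ = θ 1 - θ 0 :=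
  sub_eq_sub_of_exp_eq (ContinuousMap.continuous _) hθ
    (fun t => ((exists_exp_lift_interval (f.comp γ)).choose_spec t).trans (h t).symm) _ _

theorem exp_angleChange (f : C(X, Circle)) (γ : C(I, X)) :
    Circle.exp (angleChange f γ) = f (γ 1) / f (γ 0) := by
  have h := (exists_exp_lift_interval (f.comp γ)).choose_spec
  rw [angleChange, Circle.exp_sub, h, h]
  rfl

/-- The change of angle as an additive invariant of paths. -/
def angleCocycle (f : C(X, Circle)) : PathCocycle X ℝ where
  toFun := angleChange f
  triangle F a b c := by
    -- One lift over the plane serves all three edges, so the angle changes telescope.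
    obtain ⟨θ, hθ⟩ := exists_exp_lift (f.comp F)
    have key (a b : ℝ × ℝ) : angleChange f (mapSegment F a b) = θ b - θ a := by
      rw [angleChange_eq f (mapSegment F a b) (mapSegment θ a b).continuous fun t => hθ _]
      simp [mapSegment]
    rw [key, key, key]
    ring

/-- The change of angle along `γ`, corrected at the end points by the principal arguments so that it
becomes a multiple of `2π`, divided by `2π`. -/
def windingNumber (f : C(X, Circle)) (γ : C(I, X)) : ℤ :=
  round ((angleChange f γ - Complex.arg (f (γ 1)) + Complex.arg (f (γ 0))) / (2 * Real.pi))

/-- Rounding loses nothing: `Circle.exp` of the corrected angle change is 1, so it is already a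
multiple of `2π`. -/
theorem windingNumber_spec (f : C(X, Circle)) (γ : C(I, X)) :
    (windingNumber f γ : ℝ) * (2 * Real.pi) =
      angleChange f γ - Complex.arg (f (γ 1)) + Complex.arg (f (γ 0)) := by
  have h : Circle.exp (angleChange f γ - Complex.arg (f (γ 1)) + Complex.arg (f (γ 0))) = 1 := by
    rw [Circle.exp_add, Circle.exp_sub, exp_angleChange, Circle.exp_arg, Circle.exp_arg]
    simp
  obtain ⟨m, hm⟩ := Circle.exp_eq_one.1 h
  have hpi := Real.pi_pos
  rw [windingNumber, hm, mul_div_assoc, div_self (by positivity), mul_one, round_intCast]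

theorem windingNumber_loop (f : C(X, Circle)) {x : X} (γ : Path x x) :
    (windingNumber f γ.toContinuousMap : ℝ) * (2 * Real.pi) = angleChange f γ.toContinuousMap := by
  rw [windingNumber_spec]
  have h0 : γ.toContinuousMap 0 = x := γ.source
  have h1 : γ.toContinuousMap 1 = x := γ.target
  rw [h0, h1]
  ring

/-- The winding number as an additive invariant of paths. -/
def windingCocycle (f : C(X, Circle)) : PathCocycle X ℤ where
  toFun := windingNumber f
  triangle F a b c := by
    have h := (angleCocycle f).triangle F a b c
    have hpi := Real.pi_pos
    have key : ((windingNumber f (mapSegment F a b) + windingNumber f (mapSegment F b c) : ℤ) : ℝ) *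
        (2 * Real.pi) = (windingNumber f (mapSegment F a c) : ℝ) * (2 * Real.pi) := by
      push_cast
      rw [add_mul, windingNumber_spec, windingNumber_spec, windingNumber_spec]
      change angleChange _ _ + angleChange _ _ = angleChange _ _ at h
      rw [← h]
      simp only [mapSegment_zero, mapSegment_one]
      ring
    exact_mod_cast mul_right_cancel₀ (by positivity) key

end CircleRoot

end AngleChange

/-! ### Path cocycles and singular chains -/

section Chains

open unitInterval Simplicial

namespace CircleRoot

section Simplex

variable {X : Type u} [TopologicalSpace X]

/-- A curve as a singular `1`-simplex. -/
def curveSimplex (γ : C(I, X)) : (TopCat.toSSet.obj (TopCat.of X)) _⦋1⦌ :=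
  ((TopCat.of X).toSSetObjEquiv (Opposite.op ⦋1⦌)).symm
    (γ.comp (stdSimplexHomeomorphUnitInterval : C(stdSimplex ℝ (Fin 2), I)))

/-- A singular `1`-simplex as a curve. -/
def simplexCurve (s : (TopCat.toSSet.obj (TopCat.of X)) _⦋1⦌) : C(I, X) :=
  ((TopCat.of X).toSSetObjEquiv (Opposite.op ⦋1⦌) s).comp
    (stdSimplexHomeomorphUnitInterval.symm : C(I, stdSimplex ℝ (Fin 2)))

@[simp]
theorem curveSimplex_simplexCurve (s : (TopCat.toSSet.obj (TopCat.of X)) _⦋1⦌) :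
    curveSimplex (simplexCurve s) = s := by
  rw [curveSimplex, Equiv.symm_apply_eq]
  ext z
  exact congrArg ((TopCat.of X).toSSetObjEquiv (Opposite.op ⦋1⦌) s)
    (stdSimplexHomeomorphUnitInterval.symm_apply_apply z)

@[simp]
theorem simplexCurve_curveSimplex (γ : C(I, X)) : simplexCurve (curveSimplex γ) = γ := by
  ext t
  exact congrArg γ (stdSimplexHomeomorphUnitInterval.apply_symm_apply t)

/-- The edge of the standard triangle opposite to the vertex `i`. -/
def triangleEdge (i : Fin 3) : Path (stdSimplex.vertex (S := ℝ) (i.succAbove 0))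
    (stdSimplex.vertex (S := ℝ) (i.succAbove 1)) where
  toFun t := stdSimplex.map i.succAbove (stdSimplexHomeomorphUnitInterval.symm t)
  continuous_toFun := by
    have := stdSimplex.continuous_map (S := ℝ) i.succAbove
    fun_prop
  source' := by
    have h : stdSimplexHomeomorphUnitInterval.symm 0 = stdSimplex.vertex (S := ℝ) (0 : Fin 2) := by
      rw [Homeomorph.symm_apply_eq]
      rfl
    rw [h, stdSimplex.map_vertex]
  target' := by
    have h : stdSimplexHomeomorphUnitInterval.symm 1 = stdSimplex.vertex (S := ℝ) (1 : Fin 2) := by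
      rw [Homeomorph.symm_apply_eq]
      rfl
    rw [h, stdSimplex.map_vertex]

theorem simplexCurve_δ (τ : (TopCat.toSSet.obj (TopCat.of X)) _⦋2⦌) (i : Fin 3) :
    simplexCurve ((TopCat.toSSet.obj (TopCat.of X)).δ i τ) =
      ContinuousMap.comp ((TopCat.of X).toSSetObjEquiv (Opposite.op ⦋2⦌) τ)
        (triangleEdge i).toContinuousMap :=
  rfl

instance : SimplyConnectedSpace (stdSimplex ℝ (Fin 3)) :=
  have := (convex_stdSimplex ℝ (Fin 3)).contractibleSpace ⟨_, single_mem_stdSimplex ℝ 0⟩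
  inferInstance

/-- The cocycle condition mentions only maps of the plane, but `τ` is an arbitrary singular
triangle. In the simply connected standard triangle, edge 1 is homotopic to edge 2 followed by edge
0, so homotopy invariance and additivity of the pulled back cocycle suffice. -/
theorem PathCocycle.simplex_boundary {A : Type*} [AddCommGroup A] (Φ : PathCocycle X A)
    (τ : (TopCat.toSSet.obj (TopCat.of X)) _⦋2⦌) :
    ∑ i : Fin 3, (-1) ^ i.val •
      Φ.toFun (simplexCurve ((TopCat.toSSet.obj (TopCat.of X)).δ i τ)) = 0 := by
  let Ψ : PathCocycle (stdSimplex ℝ (Fin 3)) A := Φ.pullback ((TopCat.of X).toSSetObjEquiv (Opposite.op ⦋2⦌) τ)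
  have h : Ψ.toFun (triangleEdge 1).toContinuousMap =
      Ψ.toFun (triangleEdge 2).toContinuousMap + Ψ.toFun (triangleEdge 0).toContinuousMap := by
    rw [← Ψ.trans (x := stdSimplex.vertex 0) (y := stdSimplex.vertex 1) (z := stdSimplex.vertex 2)
      (triangleEdge 2) (triangleEdge 0)]
    exact Ψ.homotopic (SimplyConnectedSpace.paths_homotopic _ _)
  simp only [simplexCurve_δ, Fin.sum_univ_three]
  change (-1) ^ 0 • Ψ.toFun (triangleEdge 0).toContinuousMap +
    (-1) ^ 1 • Ψ.toFun (triangleEdge 1).toContinuousMap +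
    (-1) ^ 2 • Ψ.toFun (triangleEdge 2).toContinuousMap = 0
  rw [h]
  simp

end Simplex

/-- The coordinates of a point of an edge of the standard triangle, as weights. -/
theorem sum_triangleEdge_smul {E : Type*} [AddCommGroup E] [Module ℝ E] (p : Fin 3 → E) (i : Fin 3)
    (t : I) : (triangleEdge i t).1 0 • p 0 + (triangleEdge i t).1 1 • p 1 +
      (triangleEdge i t).1 2 • p 2 =
      (1 - (t : ℝ)) • p (i.succAbove 0) + (t : ℝ) • p (i.succAbove 1) := by
  -- `stdSimplex.map` pushes weights forward, so a coordinate is the sum over a fibre of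
  -- `succAbove`.
  have hz (j : Fin 3) : (triangleEdge i t).1 j =
      ∑ k with i.succAbove k = j, ![1 - (t : ℝ), t] k :=
    FunOnFinite.linearMap_apply_apply ℝ ℝ _ _ _
  rw [hz, hz, hz]
  simp only [Finset.sum_filter, Fin.sum_univ_two]
  fin_cases i
  · simp [show (0 : Fin 3).succAbove 0 = 1 from rfl, show (0 : Fin 3).succAbove 1 = 2 from rfl]
  · simp [show (1 : Fin 3).succAbove 0 = 0 from rfl, show (1 : Fin 3).succAbove 1 = 2 from rfl]
  · simp [show (2 : Fin 3).succAbove 0 = 0 from rfl, show (2 : Fin 3).succAbove 1 = 1 from rfl]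

section SimplexChain

variable (R : Type) [CommRing R] {X : Type u} [TopologicalSpace X]

/-- The inclusion of the summand of the singular chains given by a simplex. -/
def simplexChain {k : ℕ} (s : (TopCat.toSSet.obj (TopCat.of X)) _⦋k⦌) :
    ModuleCat.of R (ULift.{u} R) ⟶ (singularChains R (TopCat.of X)).X k :=
  (TopCat.toSSet.obj (TopCat.of X)).ιChainComplex s

theorem simplexChain_d {k : ℕ} (s : (TopCat.toSSet.obj (TopCat.of X)) _⦋k + 1⦌) :
    simplexChain R s ≫ (singularChains R (TopCat.of X)).d (k + 1) k =
      ∑ i : Fin (k + 2), (-1) ^ i.val •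
        simplexChain R ((TopCat.toSSet.obj (TopCat.of X)).δ i s) :=
  (TopCat.toSSet.obj (TopCat.of X)).ιChainComplex_d (R := ModuleCat.of R (ULift.{u} R)) s

variable {R}

theorem singularChains_hom_ext {k : ℕ} {T : ModuleCat.{u} R}
    {f g : (singularChains R (TopCat.of X)).X k ⟶ T}
    (h : ∀ s : (TopCat.toSSet.obj (TopCat.of X)) _⦋k⦌, simplexChain R s ≫ f = simplexChain R s ≫ g) :
    f = g :=
  SSet.chainComplex_hom_ext h

/-- The map on singular chains with given values on simplices. -/
def chainsDesc {k : ℕ} {T : ModuleCat.{u} R}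
    (φ : (TopCat.toSSet.obj (TopCat.of X)) _⦋k⦌ → (ModuleCat.of R (ULift.{u} R) ⟶ T)) :
    (singularChains R (TopCat.of X)).X k ⟶ T :=
  ((TopCat.toSSet.obj (TopCat.of X)).isColimitChainComplexXCofan (ModuleCat.of R (ULift.{u} R))
    k).desc (Limits.Cofan.mk T φ)

@[simp]
theorem simplexChain_chainsDesc {k : ℕ} {T : ModuleCat.{u} R}
    (φ : (TopCat.toSSet.obj (TopCat.of X)) _⦋k⦌ → (ModuleCat.of R (ULift.{u} R) ⟶ T))
    (s : (TopCat.toSSet.obj (TopCat.of X)) _⦋k⦌) : simplexChain R s ≫ chainsDesc φ = φ s :=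
  ((TopCat.toSSet.obj (TopCat.of X)).isColimitChainComplexXCofan (ModuleCat.of R (ULift.{u} R))
    k).fac (Limits.Cofan.mk T φ) ⟨s⟩

theorem simplexChain_chainsDesc_assoc {k : ℕ} {T S : ModuleCat.{u} R}
    (φ : (TopCat.toSSet.obj (TopCat.of X)) _⦋k⦌ → (ModuleCat.of R (ULift.{u} R) ⟶ T))
    (s : (TopCat.toSSet.obj (TopCat.of X)) _⦋k⦌) (g : T ⟶ S) :
    simplexChain R s ≫ chainsDesc φ ≫ g = φ s ≫ g := by
  rw [← Category.assoc, simplexChain_chainsDesc]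

end SimplexChain

variable (R : Type) [CommRing R] {X : Type u} [TopologicalSpace X]

/-- The chain given by a curve, modulo boundaries. -/
def curveOpcycle (γ : C(I, X)) :
    ModuleCat.of R (ULift.{u} R) ⟶ (singularChains R (TopCat.of X)).opcycles 1 :=
  simplexChain R (curveSimplex γ) ≫ (singularChains R (TopCat.of X)).pOpcycles 1

/-- The affine map of the standard triangle with vertices `a`, `b`, `c`, followed by `F`. -/
def triangleSimplex (F : C(ℝ × ℝ, X)) (p : Fin 3 → ℝ × ℝ) :
    (TopCat.toSSet.obj (TopCat.of X)) _⦋2⦌ :=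
  ((TopCat.of X).toSSetObjEquiv (Opposite.op ⦋2⦌)).symm
    (F.comp ⟨fun w : stdSimplex ℝ (Fin 3) => w.1 0 • p 0 + w.1 1 • p 1 + w.1 2 • p 2, by
      have h (i : Fin 3) : Continuous fun w : stdSimplex ℝ (Fin 3) => w.1 i :=
        (continuous_apply i).comp continuous_subtype_val
      exact (((h 0).smul continuous_const).add ((h 1).smul continuous_const)).add
        ((h 2).smul continuous_const)⟩)

theorem simplexCurve_δ_triangleSimplex (F : C(ℝ × ℝ, X)) (p : Fin 3 → ℝ × ℝ) (i : Fin 3) :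
    simplexCurve ((TopCat.toSSet.obj (TopCat.of X)).δ i (triangleSimplex F p)) =
      mapSegment F (p (i.succAbove 0)) (p (i.succAbove 1)) := by
  ext t
  exact congrArg F (sum_triangleEdge_smul p i t)

/-- The class of a curve modulo boundaries, as an additive invariant of paths. -/
def opcycleCocycle : PathCocycle X
    (ModuleCat.of R (ULift.{u} R) ⟶ (singularChains R (TopCat.of X)).opcycles 1) where
  toFun := curveOpcycle R
  triangle F a b c := by
    have hδ (i : Fin 3) :
        simplexChain R ((TopCat.toSSet.obj (TopCat.of X)).δ i (triangleSimplex F ![a, b, c])) ≫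
          (singularChains R (TopCat.of X)).pOpcycles 1 =
          curveOpcycle R (mapSegment F (![a, b, c] (i.succAbove 0))
            (![a, b, c] (i.succAbove 1))) := by
      rw [← simplexCurve_δ_triangleSimplex, curveOpcycle, curveSimplex_simplexCurve]
    -- The boundary of the affine triangle vanishes modulo boundaries; its three faces are the three
    -- segments.
    have h := congrArg (· ≫ (singularChains R (TopCat.of X)).pOpcycles 1)
      (simplexChain_d R (triangleSimplex F ![a, b, c]))
    simp only [Category.assoc, HomologicalComplex.d_pOpcycles, Limits.comp_zero,
      Preadditive.sum_comp, Preadditive.zsmul_comp, hδ] at h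
    replace h := h.trans (Fin.sum_univ_three _)
    change 0 = (-1 : ℤ) ^ 0 • curveOpcycle R (mapSegment F b c) +
      (-1 : ℤ) ^ 1 • curveOpcycle R (mapSegment F a c) +
      (-1 : ℤ) ^ 2 • curveOpcycle R (mapSegment F a b) at h
    simp only [pow_zero, one_smul, pow_one, neg_smul, even_two, Even.neg_pow, one_pow] at h
    rw [← sub_eq_zero, h]
    abel

variable {R}

namespace PathCocycle

variable {T : ModuleCat.{u} R} (Φ : PathCocycle X (ModuleCat.of R (ULift.{u} R) ⟶ T))

/-- The map on singular `1`-chains given by a path cocycle. -/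
def onChains : (singularChains R (TopCat.of X)).X 1 ⟶ T :=
  chainsDesc fun s => Φ.toFun (simplexCurve s)

@[simp]
theorem simplexChain_onChains (s : (TopCat.toSSet.obj (TopCat.of X)) _⦋1⦌) :
    simplexChain R s ≫ Φ.onChains = Φ.toFun (simplexCurve s) :=
  simplexChain_chainsDesc _ _

@[simp]
theorem d_onChains : (singularChains R (TopCat.of X)).d 2 1 ≫ Φ.onChains = 0 := by
  refine singularChains_hom_ext fun τ => ?_
  rw [← Category.assoc, simplexChain_d, Limits.comp_zero, Preadditive.sum_comp]
  simp only [Preadditive.zsmul_comp, simplexChain_onChains]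
  exact Φ.simplex_boundary τ

end PathCocycle

end CircleRoot

end Chains

/-! ### First homology and loops -/

section FirstHomology

open unitInterval Simplicial

namespace CircleRoot

variable {R : Type} [CommRing R] {X : Type u} [TopologicalSpace X]

/-- The homology class of a loop, as an element of the homology of the singular chains. -/
def loopHomologyClass (R : Type) [CommRing R] {p : X} (τ : Path p p) :
    (singularChains R (TopCat.of X)).homology 1 :=
  loopClass R τ

theorem generatesH1_iff {S : Set (Σ p : X, Path p p)} : GeneratesH1 R S ↔
    Submodule.span R ((fun τ : Σ p : X, Path p p => loopHomologyClass R τ.2) '' S) = ⊤ :=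
  Iff.rfl

theorem homologyι_loopHomologyClass {p : X} (τ : Path p p) :
    ((singularChains R (TopCat.of X)).homologyι 1).hom (loopHomologyClass R τ) =
      ((opcycleCocycle R).toFun τ.toContinuousMap).hom (ULift.up 1) := by
  have h : ((singularChains R (TopCat.of X)).liftCycles (pathChain R τ) 0 (by simp)
      (pathChain_d R τ) ≫ (singularChains R (TopCat.of X)).homologyπ 1) ≫
        (singularChains R (TopCat.of X)).homologyι 1 =
      (opcycleCocycle R).toFun τ.toContinuousMap := by
    rw [Category.assoc, HomologicalComplex.homology_π_ι, HomologicalComplex.liftCycles_i_assoc]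
    rfl
  exact congrArg (fun g => g.hom (ULift.up 1)) h

namespace PathCocycle

variable {T : ModuleCat.{u} R} (Φ : PathCocycle X (ModuleCat.of R (ULift.{u} R) ⟶ T))

/-- The map on chains modulo boundaries given by a path cocycle. -/
def onOpcycles : (singularChains R (TopCat.of X)).opcycles 1 ⟶ T :=
  (singularChains R (TopCat.of X)).descOpcycles Φ.onChains 2 (by simp) Φ.d_onChains

/-- `opcycleCocycle` is universal: this is the factorization of `Φ` through it. -/
theorem toFun_comp_onOpcycles (γ : C(I, X)) :
    (opcycleCocycle R).toFun γ ≫ Φ.onOpcycles = Φ.toFun γ := by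
  change (simplexChain R (curveSimplex γ) ≫ _) ≫ _ = _
  rw [Category.assoc, onOpcycles, HomologicalComplex.p_descOpcycles, simplexChain_onChains,
    simplexCurve_curveSimplex]

/-- The map on first homology given by a path cocycle. -/
def onHomology : (singularChains R (TopCat.of X)).homology 1 ⟶ T :=
  (singularChains R (TopCat.of X)).homologyι 1 ≫ Φ.onOpcycles

theorem onHomology_loopHomologyClass {p : X} (τ : Path p p) :
    Φ.onHomology.hom (loopHomologyClass R τ) = (Φ.toFun τ.toContinuousMap).hom (ULift.up 1) := by
  rw [← Φ.toFun_comp_onOpcycles, onHomology, ModuleCat.hom_comp, LinearMap.comp_apply,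
    homologyι_loopHomologyClass]
  rfl

end PathCocycle

/-- Parity of winding numbers can be tested on loops generating the first homology. -/
theorem even_windingNumber_of_generatesH1 (hR : ∀ k : ℤ, (k : R) ∈ Ideal.span {(2 : R)} → Even k)
    {S : Set (Σ p : X, Path p p)} (hS : GeneratesH1 R S) (f : C(X, Circle))
    (h : ∀ τ ∈ S, Even (windingNumber f τ.2.toContinuousMap)) {p : X} (γ : Path p p) :
    Even (windingNumber f γ.toContinuousMap) := by
  let Φ : PathCocycle X (ModuleCat.of R (ULift.{u} R) ⟶ ModuleCat.of R (ULift.{u} R)) :=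
    (windingCocycle f).map (zmultiplesHom _ (𝟙 _))
  -- The multiples of 2 in `R`. By `hR`, an integer whose image lies there is even; this covers `ℤ`,
  -- and also `ℤ₂`, where the ideal is zero.
  let N : Submodule R (ULift.{u} R) :=
    Submodule.comap (ULift.moduleEquiv (R := R) (M := R)).toLinearMap (Ideal.span {(2 : R)})
  have hΦ {q : X} (τ : Path q q) : Φ.onHomology.hom (loopHomologyClass R τ) =
      ULift.up ((windingNumber f τ.toContinuousMap : ℤ) : R) := by
    rw [Φ.onHomology_loopHomologyClass]
    change ((windingNumber f τ.toContinuousMap) • (𝟙 (ModuleCat.of R (ULift.{u} R)))).hom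
      (ULift.up 1) = _
    ext
    simp
  have hle : Submodule.span R ((fun τ : Σ p : X, Path p p => loopHomologyClass R τ.2) '' S) ≤
      N.comap Φ.onHomology.hom := by
    rw [Submodule.span_le]
    rintro _ ⟨τ, hτ, rfl⟩
    change Φ.onHomology.hom (loopHomologyClass R τ.2) ∈ N
    rw [hΦ]
    obtain ⟨k, hk⟩ := (h τ hτ).two_dvd
    change ((windingNumber f τ.2.toContinuousMap : ℤ) : R) ∈ Ideal.span {(2 : R)}
    rw [hk, Ideal.mem_span_singleton]
    exact ⟨k, by push_cast; rfl⟩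
  rw [generatesH1_iff.1 hS] at hle
  have hγ : Φ.onHomology.hom (loopHomologyClass R γ) ∈ N := hle trivial
  rw [hΦ] at hγ
  exact hR _ hγ

theorem comp_eq_zero_of_apply_one {S T : ModuleCat.{u} R} (g : ModuleCat.of R (ULift.{u} R) ⟶ S)
    (q : S ⟶ T) (h : q.hom (g.hom (ULift.up 1)) = 0) : g ≫ q = 0 := by
  refine ModuleCat.hom_ext (LinearMap.ext fun x => ?_)
  have hx : x = x.down • (ULift.up 1 : ULift.{u} R) := ULift.ext _ _ (by simp)
  change q.hom (g.hom x) = 0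
  rw [hx, map_smul, map_smul, h, smul_zero]

theorem curveSimplex_endpoints (γ : C(I, X)) :
    TopCat.toSSetObj₀Equiv ((TopCat.toSSet.obj (TopCat.of X)).δ 1 (curveSimplex γ)) = γ 0 ∧
      TopCat.toSSetObj₀Equiv ((TopCat.toSSet.obj (TopCat.of X)).δ 0 (curveSimplex γ)) = γ 1 := by
  constructor
  · change γ (stdSimplexHomeomorphUnitInterval (stdSimplex.map (Fin.succAbove (1 : Fin 2))
      (default : stdSimplex ℝ (Fin 1)))) = _
    rw [Subsingleton.elim (default : stdSimplex ℝ (Fin 1)) (stdSimplex.vertex 0),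
      stdSimplex.map_vertex]
    rfl
  · change γ (stdSimplexHomeomorphUnitInterval (stdSimplex.map (Fin.succAbove (0 : Fin 2))
      (default : stdSimplex ℝ (Fin 1)))) = _
    rw [Subsingleton.elim (default : stdSimplex ℝ (Fin 1)) (stdSimplex.vertex 0),
      stdSimplex.map_vertex]
    rfl

/-- The first homology is generated by the classes of loops. -/
theorem generatesH1_univ : GeneratesH1 R (Set.univ : Set (Σ p : X, Path p p)) := by
  classical
  let r : X → X := fun x => (Quotient.mk (pathSetoid X) x).out
  have hr (x : X) : Joined (r x) x := Quotient.exact (s := pathSetoid X) (Quotient.out_eq _)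
  have hrr {x y : X} (γ : Path x y) : r x = r y := by
    simp only [r]
    rw [Quotient.sound (s := pathSetoid X) (show Joined x y from ⟨γ⟩)]
  let α (x : X) : Path (r x) x := (hr x).somePath
  let toPath (γ : C(I, X)) : Path (γ 0) (γ 1) := ⟨γ, rfl, rfl⟩
  -- Each curve is closed up through the base point of its path component.
  let lp (γ : C(I, X)) : Path (r (γ 0)) (r (γ 0)) :=
    ((α (γ 0)).trans (toPath γ)).trans ((α (γ 1)).cast (hrr (toPath γ)) rfl).symm
  let K := singularChains R (TopCat.of X)
  let Θ : K.X 1 ⟶ K.homology 1 := chainsDesc fun s =>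
    K.liftCycles (pathChain R (lp (simplexCurve s))) 0 (by simp) (pathChain_d R _) ≫ K.homologyπ 1
  let B : K.X 0 ⟶ K.opcycles 1 := chainsDesc fun s =>
    (opcycleCocycle R).toFun (α (TopCat.toSSetObj₀Equiv s)).toContinuousMap
  -- Closing up changes a curve by the connecting paths at its ends, a term factoring through the
  -- boundary. On cycles this term vanishes, so there `Θ` is the projection to homology.
  have hΘ : Θ ≫ K.homologyι 1 = K.pOpcycles 1 - K.d 1 0 ≫ B := by
    refine singularChains_hom_ext fun s => ?_
    obtain ⟨γ, rfl⟩ : ∃ γ, s = curveSimplex γ := ⟨_, (curveSimplex_simplexCurve s).symm⟩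
    rw [← Category.assoc, simplexChain_chainsDesc, Category.assoc, HomologicalComplex.homology_π_ι,
      HomologicalComplex.liftCycles_i_assoc, Preadditive.comp_sub, ← Category.assoc, simplexChain_d,
      Preadditive.sum_comp]
    simp only [Preadditive.zsmul_comp, B, simplexChain_chainsDesc]
    change (opcycleCocycle R).toFun (lp (simplexCurve (curveSimplex γ))).toContinuousMap =
      (opcycleCocycle R).toFun γ - _
    rw [simplexCurve_curveSimplex]
    simp only [lp]
    rw [PathCocycle.trans, PathCocycle.symm, PathCocycle.trans, Fin.sum_univ_two]
    have h0 : TopCat.toSSetObj₀Equiv ((TopCat.toSSet.obj (TopCat.of X)).δ 0 (curveSimplex γ)) =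
        γ 1 := (curveSimplex_endpoints γ).2
    have h1 : TopCat.toSSetObj₀Equiv ((TopCat.toSSet.obj (TopCat.of X)).δ 1 (curveSimplex γ)) =
        γ 0 := (curveSimplex_endpoints γ).1
    rw [h0, h1]
    change _ + (opcycleCocycle R).toFun γ + -(opcycleCocycle R).toFun (α (γ 1)).toContinuousMap = _
    simp only [Fin.val_zero, pow_zero, one_smul, Fin.val_one, pow_one, neg_smul]
    abel
  have hmem (z : K.X 1) : Θ.hom z ∈
      Submodule.span R ((fun τ : Σ p : X, Path p p => loopHomologyClass R τ.2) '' Set.univ) := by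
    rw [← Submodule.Quotient.mk_eq_zero]
    let N : Submodule R (K.homology 1) := Submodule.span R
      ((fun τ : Σ p : X, Path p p => loopHomologyClass R τ.2) '' Set.univ)
    let q : K.homology 1 ⟶ ModuleCat.of R (K.homology 1 ⧸ N) := ModuleCat.ofHom N.mkQ
    have h : Θ ≫ q = 0 := by
      refine singularChains_hom_ext fun s => ?_
      rw [simplexChain_chainsDesc_assoc, Limits.comp_zero]
      refine comp_eq_zero_of_apply_one _ _ ((Submodule.Quotient.mk_eq_zero N).2 ?_)
      exact Submodule.subset_span ⟨⟨_, lp (simplexCurve s)⟩, trivial, rfl⟩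
    exact congrArg (fun g => g.hom z) h
  rw [generatesH1_iff, eq_top_iff]
  intro c _
  obtain ⟨z, rfl⟩ := (ModuleCat.epi_iff_surjective (K.homologyπ 1)).1 inferInstance c
  have hz : K.homologyπ 1 z = Θ.hom (K.iCycles 1 z) := by
    apply (ModuleCat.mono_iff_injective (K.homologyι 1)).1 inferInstance
    have h := congrArg (K.iCycles 1 ≫ ·) hΘ
    simp only [Preadditive.comp_sub, HomologicalComplex.iCycles_d_assoc, Limits.zero_comp,
      sub_zero] at h
    rw [← HomologicalComplex.homology_π_ι] at h
    exact (congrArg (fun g => g.hom z) h).symm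
  rw [hz]
  exact hmem _

end CircleRoot

end FirstHomology

/-! ### Pullback of singular cocycles -/

section CocyclePullback

open unitInterval Simplicial

namespace CircleRoot

/-- A map of cochain complexes of modules is zero on `H¹` if and only if it sends cocycles to
coboundaries. -/
theorem homologyMap_one_eq_zero_iff {R : Type*} [Ring R] {K L : CochainComplex (ModuleCat.{u} R) ℕ}
    (φ : K ⟶ L) : HomologicalComplex.homologyMap φ 1 = 0 ↔
      ∀ z : K.X 1, (K.d 1 2).hom z = 0 → ∃ y : L.X 0, (L.d 0 1).hom y = (φ.f 1).hom z := by
  have h1 : HomologicalComplex.homologyMap φ 1 = 0 ↔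
      K.iCycles 1 ≫ φ.f 1 ≫ L.pOpcycles 1 = 0 := by
    rw [← cancel_epi (K.homologyπ 1), ← cancel_mono (L.homologyι 1)]
    simp
  -- The short complex uses `next 1` and `prev 1`; replacing them by 2 and 0 requires generalizing
  -- the index first.
  have hg (z : K.X 1) : (K.sc 1).g.hom z = 0 ↔ (K.d 1 2).hom z = 0 := by
    have (j : ℕ) (hj : (ComplexShape.up ℕ).next 1 = j) :
        (K.sc 1).g.hom z = 0 ↔ (K.d 1 j).hom z = 0 := by
      subst hj
      rfl
    exact this 2 (by simp)
  have hf (x : L.X 1) : x ∈ LinearMap.range (L.sc 1).f.hom ↔ ∃ y : L.X 0, (L.d 0 1).hom y = x := by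
    have (j : ℕ) (hj : (ComplexShape.up ℕ).prev 1 = j) :
        x ∈ LinearMap.range (L.sc 1).f.hom ↔ ∃ y : L.X j, (L.d j 1).hom y = x := by
      subst hj
      rfl
    exact this 0 (by simp)
  rw [h1]
  constructor
  · intro h z hz
    refine (hf _).1 (((L.sc 1).moduleCat_pOpcycles_eq_zero_iff _).1 ?_)
    have e : (K.iCycles 1).hom ((K.sc 1).moduleCatCyclesIso.inv.hom ⟨z, (hg z).2 hz⟩) = z :=
      (K.sc 1).moduleCatCyclesIso_inv_iCycles_apply ⟨z, (hg z).2 hz⟩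
    have h2 : (L.pOpcycles 1).hom ((φ.f 1).hom ((K.iCycles 1).hom
        ((K.sc 1).moduleCatCyclesIso.inv.hom ⟨z, (hg z).2 hz⟩))) = 0 :=
      congrArg (fun g => g.hom ((K.sc 1).moduleCatCyclesIso.inv.hom ⟨z, (hg z).2 hz⟩)) h
    rw [e] at h2
    exact h2
  · intro h
    refine ModuleCat.hom_ext (LinearMap.ext fun c => ?_)
    change (L.pOpcycles 1).hom ((φ.f 1).hom ((K.iCycles 1).hom c)) = 0
    refine ((L.sc 1).moduleCat_pOpcycles_eq_zero_iff _).2 ((hf _).2 (h _ ?_))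
    exact congrArg (fun g => g.hom c) (K.iCycles_d 1 2)

/-- In the Hom complexes, cochains are morphisms out of chains and differentials are
precompositions, so this is the module criterion by unfolding. -/
theorem cohomologyPullback_one_eq_zero_iff (A : ModuleCat.{u} ℤ) {X Y : TopCat.{u}} (f : X ⟶ Y) :
    cohomologyPullback A f 1 = 0 ↔
      ∀ z : (singularChains ℤ Y).X 1 ⟶ A, (singularChains ℤ Y).d 2 1 ≫ z = 0 →
        ∃ y : (singularChains ℤ X).X 0 ⟶ A,
          (singularChains ℤ X).d 1 0 ≫ y = (singularChainsMap ℤ f).f 1 ≫ z :=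
  homologyMap_one_eq_zero_iff _

section

variable {X Y : Type u} [TopologicalSpace X] [TopologicalSpace Y] {A : ModuleCat.{u} ℤ}

theorem simplexChain_map (R : Type) [CommRing R] (f : C(X, Y)) (γ : C(I, X)) :
    simplexChain R (curveSimplex γ) ≫ (singularChainsMap R (TopCat.ofHom f)).f 1 =
      simplexChain R (curveSimplex (f.comp γ)) :=
  SSet.ι_chainComplexMap_f (X := TopCat.toSSet.obj (TopCat.of X))
    (Y := TopCat.toSSet.obj (TopCat.of Y)) (TopCat.toSSet.map (TopCat.ofHom f))
    (R := ModuleCat.of R (ULift.{u} R)) (curveSimplex γ)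

theorem simplexChain_curve_d (R : Type) [CommRing R] (γ : C(I, X)) :
    simplexChain R (curveSimplex γ) ≫ (singularChains R (TopCat.of X)).d 1 0 =
      simplexChain R (TopCat.toSSetObj₀Equiv.symm (γ 1)) -
        simplexChain R (TopCat.toSSetObj₀Equiv.symm (γ 0)) := by
  rw [simplexChain_d, Fin.sum_univ_two, ← (curveSimplex_endpoints γ).1,
    ← (curveSimplex_endpoints γ).2, Equiv.symm_apply_apply, Equiv.symm_apply_apply]
  simp only [Fin.val_zero, pow_zero, one_smul, Fin.val_one, pow_one, neg_smul]
  exact (sub_eq_add_neg _ _).symm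

/-- The path cocycle given by a singular cocycle. -/
def cocyclePath (z : (singularChains ℤ (TopCat.of X)).X 1 ⟶ A)
    (hz : (singularChains ℤ (TopCat.of X)).d 2 1 ≫ z = 0) :
    PathCocycle X (ModuleCat.of ℤ (ULift.{u} ℤ) ⟶ A) :=
  (opcycleCocycle ℤ).map
    (Preadditive.rightComp _ ((singularChains ℤ (TopCat.of X)).descOpcycles z 2 (by simp) hz))

theorem cocyclePath_toFun (z : (singularChains ℤ (TopCat.of X)).X 1 ⟶ A)
    (hz : (singularChains ℤ (TopCat.of X)).d 2 1 ≫ z = 0) (γ : C(I, X)) :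
    (cocyclePath z hz).toFun γ = simplexChain ℤ (curveSimplex γ) ≫ z := by
  change (simplexChain ℤ (curveSimplex γ) ≫ (singularChains ℤ (TopCat.of X)).pOpcycles 1) ≫ _ = _
  rw [Category.assoc, HomologicalComplex.p_descOpcycles]

/-- The pullback on `H¹` is zero if and only if the pullback of every cocycle vanishes on loops. -/
theorem cohomologyPullback_eq_zero_iff_loops (f : C(X, Y)) :
    cohomologyPullback A (TopCat.ofHom f) 1 = 0 ↔
      ∀ z : (singularChains ℤ (TopCat.of Y)).X 1 ⟶ A,
        (singularChains ℤ (TopCat.of Y)).d 2 1 ≫ z = 0 →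
        ∀ (x : X) (γ : Path x x), simplexChain ℤ (curveSimplex (f.comp γ.toContinuousMap)) ≫ z = 0 := by
  rw [cohomologyPullback_one_eq_zero_iff]
  refine forall₂_congr fun z hz => ?_
  constructor
  · rintro ⟨y, hy⟩ x γ
    rw [← simplexChain_map, Category.assoc, ← hy, ← Category.assoc, simplexChain_curve_d]
    have h0 : γ.toContinuousMap 0 = x := γ.source
    have h1 : γ.toContinuousMap 1 = x := γ.target
    rw [h0, h1, sub_self, Limits.zero_comp]
  · intro h
    -- Vanishing on loops yields a potential, which is the required 0-cochain.
    obtain ⟨v, hv⟩ := ((cocyclePath z hz).pullback f).exists_potential (fun x γ => by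
      change (cocyclePath z hz).toFun _ = 0
      rw [cocyclePath_toFun]
      exact h x γ)
    refine ⟨chainsDesc fun s => v (TopCat.toSSetObj₀Equiv s), singularChains_hom_ext fun s => ?_⟩
    obtain ⟨γ, rfl⟩ : ∃ γ, s = curveSimplex γ := ⟨_, (curveSimplex_simplexCurve s).symm⟩
    rw [← Category.assoc, ← Category.assoc, simplexChain_map, simplexChain_curve_d,
      Preadditive.sub_comp, simplexChain_chainsDesc, simplexChain_chainsDesc,
      ← cocyclePath_toFun z hz, Equiv.apply_symm_apply, Equiv.apply_symm_apply]
    exact (hv _ _ ⟨γ, rfl, rfl⟩).symm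

end

/-- An additive invariant of paths in the circle is multiplicative in the winding number. -/
theorem PathCocycle.toFun_eq_zero_of_even {B : Type*} [AddCommGroup B] (hB : ∀ x : B, x + x = 0)
    (Ψ : PathCocycle Circle B) {p : Circle} (γ : Path p p)
    (h : Even (windingNumber (ContinuousMap.id Circle) γ.toContinuousMap)) :
    Ψ.toFun γ.toContinuousMap = 0 := by
  obtain ⟨θ, hθ⟩ := exists_exp_lift_interval γ.toContinuousMap
  let e : C(ℝ, Circle) := Circle.exp
  let τ : Path (θ 0) (θ 1) := ⟨θ, rfl, rfl⟩
  let τ' : Path (θ 0) (θ 1) := ⟨mapSegment (ContinuousMap.id ℝ) (θ 0) (θ 1), by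
    change mapSegment (ContinuousMap.id ℝ) (θ 0) (θ 1) 0 = _
    simp, by
    change mapSegment (ContinuousMap.id ℝ) (θ 0) (θ 1) 1 = _
    simp⟩
  have h1 : Ψ.toFun γ.toContinuousMap = (Ψ.pullback e).toFun τ.toContinuousMap :=
    congrArg Ψ.toFun (ContinuousMap.ext fun t => (hθ t).symm)
  -- In `ℝ` the lifted loop may be straightened to a segment.
  have h2 : Ψ.toFun γ.toContinuousMap = Ψ.toFun (mapSegment e (θ 0) (θ 1)) :=
    h1.trans ((Ψ.pullback e).homotopic (SimplyConnectedSpace.paths_homotopic τ τ'))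
  obtain ⟨m, hm⟩ := h
  have h3 : θ 1 = θ 0 + m * (2 * Real.pi) + m * (2 * Real.pi) := by
    have h4 := windingNumber_loop (ContinuousMap.id Circle) γ
    rw [angleChange_eq (ContinuousMap.id Circle) γ.toContinuousMap θ.continuous hθ, hm] at h4
    push_cast at h4
    linarith
  -- The winding number is `m + m`, so the segment splits into two halves differing by a translation
  -- by `2πm`; `e` gives them the same image, and the value is of the form `x + x`.
  have h5 : mapSegment e (θ 0 + m * (2 * Real.pi)) (θ 1) =
      mapSegment e (θ 0) (θ 0 + m * (2 * Real.pi)) := by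
    ext1 t
    refine Circle.exp_eq_exp.2 ⟨m, ?_⟩
    rw [h3]
    simp only [smul_eq_mul]
    ring
  rw [h2, ← Ψ.triangle_real e (θ 0) (θ 0 + m * (2 * Real.pi)) (θ 1), h5, hB]

/-- The reduction `ℤ → ℤ₂` as a morphism of modules. -/
def intCastModTwo : ModuleCat.of ℤ (ULift.{u} ℤ) ⟶ ModuleCat.of ℤ (ULift.{u} (ZMod 2)) :=
  ModuleCat.ofHom (ULift.moduleEquiv.symm.toLinearMap ∘ₗ
    (Int.castAddHom (ZMod 2)).toIntLinearMap ∘ₗ ULift.moduleEquiv.toLinearMap)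

theorem zsmul_intCastModTwo_eq_zero_iff (k : ℤ) : k • intCastModTwo.{u} = 0 ↔ Even k := by
  rw [← ZMod.intCast_eq_zero_iff_even]
  constructor
  · intro h
    have h1 := congrArg (fun g => (g.hom (ULift.up 1)).down) h
    simpa [intCastModTwo] using h1
  · intro h
    refine ModuleCat.hom_ext (LinearMap.ext fun x => ULift.ext _ _ ?_)
    simp [intCastModTwo, h]

/-- One direction evaluates the pullback of the circle's own winding cocycle modulo 2; the other
holds because every `ℤ₂`-valued cocycle on the circle kills loops of even winding number. The maps
`up` and `down` only change the universe. -/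
theorem cohomologyPullback_toCircleHom_eq_zero_iff {X : Type u} [TopologicalSpace X]
    (f : C(X, Circle)) :
    cohomologyPullback (ModuleCat.of ℤ (ULift.{u} (ZMod 2))) (toCircleHom f) 1 = 0 ↔
      ∀ (x : X) (γ : Path x x), Even (windingNumber f γ.toContinuousMap) := by
  let up : C(Circle, ULift.{u} Circle) := ⟨ULift.up, continuous_uliftUp⟩
  let down : C(ULift.{u} Circle, Circle) := ⟨ULift.down, continuous_uliftDown⟩
  refine (cohomologyPullback_eq_zero_iff_loops (up.comp f)).trans ⟨fun h x γ => ?_,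
    fun h z hz x γ => ?_⟩
  · let Φ : PathCocycle (ULift.{u} Circle)
        (ModuleCat.of ℤ (ULift.{u} ℤ) ⟶ ModuleCat.of ℤ (ULift.{u} (ZMod 2))) :=
      (windingCocycle down).map (zmultiplesHom _ intCastModTwo)
    have h1 := h Φ.onChains Φ.d_onChains x γ
    rw [Φ.simplexChain_onChains, simplexCurve_curveSimplex] at h1
    exact (zsmul_intCastModTwo_eq_zero_iff _).1 h1
  · rw [← cocyclePath_toFun z hz]
    refine PathCocycle.toFun_eq_zero_of_even (fun g => ?_) ((cocyclePath z hz).pullback up)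
      (γ.map f.continuous) (h x γ)
    refine ModuleCat.hom_ext (LinearMap.ext fun x => ULift.ext _ _ ?_)
    exact CharTwo.add_self_eq_zero (g.hom x).down

end CircleRoot

end CocyclePullback

/-! ### Line integrals and changes of angle -/

section LineIntegral

open unitInterval

namespace CircleRoot

variable {n : ℕ} {M : Type u} [TopologicalSpace M] [ChartedSpace (EuclideanSpace ℝ (Fin n)) M]

theorem contMDiff_coe_circle {m : WithTop ℕ∞} : ContMDiff (𝓡 1) 𝓘(ℝ, ℂ) m fun z : Circle => (z : ℂ) :=
  haveI : Fact (Module.finrank ℝ ℂ = 1 + 1) := ⟨Complex.finrank_real_complex⟩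
  contMDiff_coe_sphere

/-- A `C¹` curve in the unit circle of `ℂ` has logarithmic derivative `f' = i g f` with `g` real. -/
theorem derivWithin_circle {f : ℝ → ℂ} (hf : DifferentiableOn ℝ f (Set.Icc 0 1))
    (hn : ∀ t, ‖f t‖ = 1) {t : ℝ} (ht : t ∈ Set.Icc (0 : ℝ) 1) :
    derivWithin f (Set.Icc 0 1) t = Complex.I * f t *
      (((Complex.I * f t)⁻¹ * derivWithin f (Set.Icc 0 1) t).re : ℂ) := by
  have hd := (hf t ht).hasDerivWithinAt
  have hne : f t ≠ 0 := norm_ne_zero_iff.1 (by simp [hn])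
  -- Differentiating `‖f‖² = 1`; since `f⁻¹` is the conjugate of `f`, this orthogonality is exactly
  -- the reality of `f' / (i f)`.
  have h0 : inner ℝ (f t) (derivWithin f (Set.Icc 0 1) t) = 0 := by
    have h1 := hd.norm_sq
    simp only [hn] at h1
    have h2 := (uniqueDiffOn_Icc (zero_lt_one' ℝ) t ht).eq_deriv _ h1 (hasDerivWithinAt_const t _ _)
    simpa using h2
  have him : ((Complex.I * f t)⁻¹ * derivWithin f (Set.Icc 0 1) t).im = 0 := by
    have h3 : (f t)⁻¹ = (starRingEnd ℂ) (f t) := Complex.inv_eq_conj (hn t)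
    rw [mul_inv, Complex.inv_I, h3]
    rw [mul_assoc, neg_mul, Complex.neg_im, Complex.I_mul_im, neg_eq_zero, mul_comm]
    exact h0
  have hre : ((((Complex.I * f t)⁻¹ * derivWithin f (Set.Icc 0 1) t).re : ℝ) : ℂ) =
      (Complex.I * f t)⁻¹ * derivWithin f (Set.Icc 0 1) t :=
    Complex.ext (by simp) (by rw [him]; simp)
  rw [hre, mul_inv_cancel_left₀ (mul_ne_zero Complex.I_ne_zero hne)]

/-- The integral of the logarithmic derivative of a `C¹` curve in the circle is the change of
angle. -/
theorem exists_angle_of_contDiffOn {c : ℝ → Circle}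
    (hf : ContDiffOn ℝ 1 (fun t => (c t : ℂ)) (Set.Icc 0 1)) :
    ∃ θ : ℝ → ℝ, Continuous θ ∧ (∀ t ∈ Set.Icc (0 : ℝ) 1, Circle.exp (θ t) = c t) ∧
      θ 1 - θ 0 = ∫ t in (0 : ℝ)..1,
        ((Complex.I * (c t : ℂ))⁻¹ * derivWithin (fun t => (c t : ℂ)) (Set.Icc 0 1) t).re := by
  set f : ℝ → ℂ := fun t => (c t : ℂ) with hfdef
  set g : ℝ → ℝ := fun t => ((Complex.I * f t)⁻¹ * derivWithin f (Set.Icc 0 1) t).re with hg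
  have hdiff : DifferentiableOn ℝ f (Set.Icc 0 1) := hf.differentiableOn one_ne_zero
  have hne (t : ℝ) : f t ≠ 0 := Circle.coe_ne_zero _
  have hgc : ContinuousOn g (Set.Icc 0 1) := by
    have h1 := hf.continuousOn_derivWithin (uniqueDiffOn_Icc zero_lt_one) le_rfl
    have h2 : ContinuousOn (fun t => (Complex.I * f t)⁻¹) (Set.Icc 0 1) :=
      (continuousOn_const.mul hf.continuousOn).inv₀ fun t _ =>
        mul_ne_zero Complex.I_ne_zero (hne t)
    exact Complex.continuous_re.comp_continuousOn (h2.mul h1)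
  -- Extending `g` continuously beyond `[0, 1]` makes its primitive differentiable on all of `ℝ`.
  set G : ℝ → ℝ := Set.IccExtend zero_le_one ((Set.Icc (0 : ℝ) 1).domRestrict g) with hG
  have hGc : Continuous G := (continuousOn_iff_continuous_domRestrict.1 hgc).Icc_extend'
  have hGg {t : ℝ} (ht : t ∈ Set.Icc (0 : ℝ) 1) : G t = g t := by
    rw [hG, Set.IccExtend_of_mem _ _ ht]
    rfl
  set θ : ℝ → ℝ := fun t => Complex.arg (f 0) + ∫ s in (0 : ℝ)..t, G s with hθ
  have hθd (t : ℝ) : HasDerivAt θ (G t) t :=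
    (intervalIntegral.integral_hasDerivAt_right (hGc.intervalIntegrable _ _)
      hGc.stronglyMeasurable.stronglyMeasurableAtFilter hGc.continuousAt).const_add _
  have hθc : Continuous θ := continuous_iff_continuousAt.2 fun t => (hθd t).continuousAt
  -- The right derivative of `f e^{-iθ}` is zero, so it keeps its initial value, which is 1 by the
  -- choice of `θ 0`.
  have hconst : ∀ t ∈ Set.Icc (0 : ℝ) 1, f t * Complex.exp (-(θ t * Complex.I)) =
      f 0 * Complex.exp (-(θ 0 * Complex.I)) := by
    refine constant_of_has_deriv_right_zero ?_ fun t ht => ?_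
    · exact hf.continuousOn.mul (by fun_prop)
    · have ht' : t ∈ Set.Icc (0 : ℝ) 1 := Set.Ico_subset_Icc_self ht
      have h1 : HasDerivWithinAt f (derivWithin f (Set.Icc 0 1) t) (Set.Ici t) t :=
        (hdiff t ht').hasDerivWithinAt.mono_of_mem_nhdsWithin
          (Filter.mem_of_superset (Icc_mem_nhdsGE ht.2) (Set.Icc_subset_Icc_left ht.1))
      have h2 : HasDerivWithinAt (fun t => Complex.exp (-(θ t * Complex.I)))
          (Complex.exp (-(θ t * Complex.I)) * -(G t * Complex.I)) (Set.Ici t) t :=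
        (((hθd t).ofReal_comp.mul_const Complex.I).neg.cexp).hasDerivWithinAt
      have h4 := h1.mul h2
      have h3 := derivWithin_circle hdiff (fun t => Circle.norm_coe (c t)) ht'
      change _ = Complex.I * f t * (g t : ℂ) at h3
      rw [h3, hGg ht', show Complex.I * f t * (g t : ℂ) * Complex.exp (-(θ t * Complex.I)) +
        f t * (Complex.exp (-(θ t * Complex.I)) * -(g t * Complex.I)) = 0 by ring] at h4
      exact h4
  have hθ0 : θ 0 = Complex.arg (f 0) := by simp [hθ]
  refine ⟨θ, hθc, fun t ht => Circle.ext ?_, ?_⟩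
  · have h1 := hconst t ht
    have h2 : f 0 * Complex.exp (-(θ 0 * Complex.I)) = 1 := by
      rw [hθ0, Complex.exp_neg, ← Circle.coe_exp, Circle.exp_arg]
      exact mul_inv_cancel₀ (hne 0)
    rw [h2, Complex.exp_neg] at h1
    rw [Circle.coe_exp]
    exact (mul_inv_eq_one₀ (Complex.exp_ne_zero _)).1 h1 |>.symm
  · simp only [hθ, intervalIntegral.integral_same, add_zero, add_sub_cancel_left]
    refine intervalIntegral.integral_congr fun t ht => ?_
    rw [Set.uIcc_of_le zero_le_one] at ht
    exact hGg ht

theorem angularIntegral_eq_angleChange [IsManifold (𝓡 n) 1 M] {β : M → Circle}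
    (hβ : ContMDiff (𝓡 n) (𝓡 1) 1 β) {p q : M} (γ : Path p q) (hγ : IsC1Path n γ) :
    angularIntegral (n := n) β γ = angleChange ⟨β, hβ.continuous⟩ γ.toContinuousMap := by
  have hF : ContMDiff (𝓡 n) 𝓘(ℝ, ℂ) 1 fun y : M => (β y : ℂ) := contMDiff_coe_circle.comp hβ
  have hf : ContDiffOn ℝ 1 (fun t => (β (γ.extend t) : ℂ)) (Set.Icc 0 1) :=
    contMDiffOn_iff_contDiffOn.1 (hF.comp_contMDiffOn hγ)
  obtain ⟨θ, hθ, hexp, hint⟩ := exists_angle_of_contDiffOn (c := fun t => β (γ.extend t)) hf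
  rw [angleChange_eq ⟨β, hβ.continuous⟩ γ.toContinuousMap (θ := fun t : I => θ t) (by fun_prop)
    fun t => (hexp t t.2).trans (congrArg β (γ.extend_extends' t))]
  change _ = θ 1 - θ 0
  rw [hint]
  refine intervalIntegral.integral_congr_ae ?_
  -- At an end point the two-sided `mfderiv` of the extended path need not be the one-sided
  -- derivative. The integration interval already omits 0, and 1 is a null set.
  have h1 : ∀ᵐ t : ℝ, t ≠ 1 := by
    simp [MeasureTheory.ae_iff]
  filter_upwards [h1] with t ht1 ht
  rw [Set.uIoc_of_le zero_le_one] at ht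
  have hnhds : Set.Icc (0 : ℝ) 1 ∈ nhds t := Icc_mem_nhds ht.1 (lt_of_le_of_ne ht.2 ht1)
  have hd1 : MDifferentiableAt 𝓘(ℝ, ℝ) (𝓡 n) γ.extend t :=
    (hγ.contMDiffAt hnhds).mdifferentiableAt one_ne_zero
  have hd2 : MDifferentiableAt (𝓡 n) 𝓘(ℝ, ℂ) (fun y : M => (β y : ℂ)) (γ.extend t) :=
    (hF _).mdifferentiableAt one_ne_zero
  have h2 := mfderiv_comp t hd2 hd1
  have h3 : deriv (fun t => (β (γ.extend t) : ℂ)) t = circleDifferential β (γ.extend t)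
      (mfderiv 𝓘(ℝ, ℝ) (𝓡 n) γ.extend t (1 : ℝ)) := by
    rw [← fderiv_apply_one_eq_deriv, ← mfderiv_eq_fderiv]
    exact congrArg (fun L : ℝ →L[ℝ] ℂ => L 1) h2
  rw [angularForm, derivWithin_of_mem_nhds hnhds, h3]

end CircleRoot

end LineIntegral

/-! ### Smooth representatives of homotopy classes of paths -/

section SmoothPath

open unitInterval Filter Topology

namespace CircleRoot

variable (n : ℕ) {M : Type u} [TopologicalSpace M] [ChartedSpace (EuclideanSpace ℝ (Fin n)) M]

/-- A smooth path that is constant near its end points. -/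
structure IsSmoothPath {p q : M} (γ : Path p q) : Prop where
  contMDiff : ContMDiff 𝓘(ℝ, ℝ) (𝓡 n) ∞ γ.extend
  eventually_zero : ∀ᶠ t in 𝓝 (0 : ℝ), γ.extend t = p
  eventually_one : ∀ᶠ t in 𝓝 (1 : ℝ), γ.extend t = q

variable {n}

theorem IsSmoothPath.isC1Path {p q : M} {γ : Path p q} (h : IsSmoothPath n γ) : IsC1Path n γ :=
  (h.contMDiff.of_le (by exact_mod_cast le_top)).contMDiffOn

/-- Constancy near the ends makes the concatenation locally constant at the junction, so no
derivatives have to be matched. -/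
theorem IsSmoothPath.trans {p q r : M} {γ : Path p q} {γ' : Path q r} (h : IsSmoothPath n γ)
    (h' : IsSmoothPath n γ') : IsSmoothPath n (γ.trans γ') := by
  have t1 (a : ℝ) : Tendsto (fun t : ℝ => 2 * t) (𝓝 a) (𝓝 (2 * a)) :=
    (continuous_const.mul continuous_id).continuousAt
  have t2 (a : ℝ) : Tendsto (fun t : ℝ => 2 * t - 1) (𝓝 a) (𝓝 (2 * a - 1)) :=
    ((continuous_const.mul continuous_id).sub continuous_const).continuousAt
  refine ⟨fun t => ?_, ?_, ?_⟩
  · rcases lt_trichotomy t (1 / 2) with ht | rfl | ht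
    · have h1 : ContMDiffAt 𝓘(ℝ, ℝ) (𝓡 n) ∞ (fun t : ℝ => γ.extend (2 * t)) t :=
        (h.contMDiff.comp (contDiff_const.mul contDiff_id).contMDiff) t
      refine h1.congr_of_eventuallyEq ?_
      filter_upwards [Iio_mem_nhds ht] with s hs
      exact γ.extend_trans_of_le_half γ' (le_of_lt hs)
    · have h1 : ContMDiffAt 𝓘(ℝ, ℝ) (𝓡 n) ∞ (fun _ : ℝ => q) (1 / 2) := contMDiffAt_const
      refine h1.congr_of_eventuallyEq ?_
      have e1 := (t1 (1 / 2)).eventually (p := fun t => γ.extend t = q)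
        (by norm_num; exact h.eventually_one)
      have e2 := (t2 (1 / 2)).eventually (p := fun t => γ'.extend t = q)
        (by norm_num; exact h'.eventually_zero)
      filter_upwards [e1, e2] with s hs1 hs2
      rcases le_total s (1 / 2) with hs | hs
      · rw [γ.extend_trans_of_le_half γ' hs, hs1]
      · rw [γ.extend_trans_of_half_le γ' hs, hs2]
    · have h1 : ContMDiffAt 𝓘(ℝ, ℝ) (𝓡 n) ∞ (fun t : ℝ => γ'.extend (2 * t - 1)) t :=
        (h'.contMDiff.comp ((contDiff_const.mul contDiff_id).sub contDiff_const).contMDiff) t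
      refine h1.congr_of_eventuallyEq ?_
      filter_upwards [Ioi_mem_nhds ht] with s hs
      exact γ.extend_trans_of_half_le γ' (le_of_lt hs)
  · have e1 := (t1 0).eventually (p := fun t => γ.extend t = p)
      (by norm_num; exact h.eventually_zero)
    filter_upwards [e1, Iio_mem_nhds (show (0 : ℝ) < 1 / 2 by norm_num)] with s hs1 hs
    rw [γ.extend_trans_of_le_half γ' (le_of_lt hs), hs1]
  · have e2 := (t2 1).eventually (p := fun t => γ'.extend t = r)
      (by norm_num; exact h'.eventually_one)
    filter_upwards [e2, Ioi_mem_nhds (show (1 / 2 : ℝ) < 1 by norm_num)] with s hs2 hs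
    rw [γ.extend_trans_of_half_le γ' (le_of_lt hs), hs2]

variable (n) in
/-- A path that is homotopic to a smooth path constant near its end points. -/
def IsSmoothable {p q : M} (γ : Path p q) : Prop :=
  ∃ γ' : Path p q, IsSmoothPath n γ' ∧ γ'.Homotopic γ

theorem IsSmoothable.trans {p q r : M} {γ : Path p q} {γ' : Path q r} (h : IsSmoothable n γ)
    (h' : IsSmoothable n γ') : IsSmoothable n (γ.trans γ') := by
  obtain ⟨τ, hτ, hγ⟩ := h
  obtain ⟨τ', hτ', hγ'⟩ := h'
  exact ⟨τ.trans τ', hτ.trans hτ', hγ.hcomp hγ'⟩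

theorem IsSmoothable.of_homotopic {p q : M} {γ γ' : Path p q} (h : IsSmoothable n γ)
    (hγ : γ.Homotopic γ') : IsSmoothable n γ' := by
  obtain ⟨τ, hτ, hτγ⟩ := h
  exact ⟨τ, hτ, hτγ.trans hγ⟩

theorem isSmoothable_refl (p : M) : IsSmoothable n (Path.refl p) := by
  refine ⟨Path.refl p, ⟨?_, ?_, ?_⟩, Path.Homotopic.refl _⟩
  · have : ⇑(Path.refl p).extend = fun _ => p := by ext t; simp
    rw [this]
    exact contMDiff_const
  · exact Eventually.of_forall fun t => by simp
  · exact Eventually.of_forall fun t => by simp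

theorem IsSmoothable.cast {p q p' q' : M} {γ : Path p q} (h : IsSmoothable n γ) (hp : p' = p)
    (hq : q' = q) : IsSmoothable n (γ.cast hp hq) := by
  subst hp hq
  exact h

variable [IsManifold (𝓡 n) ∞ M]

/-- Paths in a convex piece of a chart are smoothable. -/
theorem isSmoothable_of_convex (x : M) {B : Set (EuclideanSpace ℝ (Fin n))}
    (hB : B ⊆ (chartAt (EuclideanSpace ℝ (Fin n)) x).target) (hc : Convex ℝ B) {p q : M}
    (γ : Path p q) (hγ : ∀ t, γ t ∈ (chartAt (EuclideanSpace ℝ (Fin n)) x).source ∧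
      chartAt (EuclideanSpace ℝ (Fin n)) x (γ t) ∈ B) : IsSmoothable n γ := by
  set e := chartAt (EuclideanSpace ℝ (Fin n)) x with he
  let φ : B → M := fun z => e.symm z
  have hφ : Continuous φ := continuousOn_iff_continuous_domRestrict.1 (e.continuousOn_symm.mono hB)
  have key {a b : B} (τ : Path a b) : IsSmoothable n (τ.map hφ) := by
    -- A smooth step, constant outside `[1/3, 2/3]`: the segment traversed with it rests near both
    -- ends.
    let s : ℝ → ℝ := fun t => Real.smoothTransition (3 * t - 1)
    have hs0 {t : ℝ} (ht : t ≤ 1 / 3) : s t = 0 :=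
      Real.smoothTransition.zero_of_nonpos (by linarith)
    have hs1 {t : ℝ} (ht : 2 / 3 ≤ t) : s t = 1 :=
      Real.smoothTransition.one_of_one_le (by linarith)
    have hsc : ContDiff ℝ ∞ s :=
      Real.smoothTransition.contDiff.comp ((contDiff_const.mul contDiff_id).sub contDiff_const)
    let l : ℝ → EuclideanSpace ℝ (Fin n) := fun t => (1 - s t) • (a : _) + s t • (b : _)
    have hlc : ContDiff ℝ ∞ l :=
      ((contDiff_const.sub hsc).smul contDiff_const).add (hsc.smul contDiff_const)
    have hlB (t : ℝ) : l t ∈ B := hc a.2 b.2 (sub_nonneg.2 (Real.smoothTransition.le_one _))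
      (Real.smoothTransition.nonneg _) (by ring)
    have hl0 {t : ℝ} (ht : t ≤ 1 / 3) : l t = a := by simp [l, hs0 ht]
    have hl1 {t : ℝ} (ht : 2 / 3 ≤ t) : l t = b := by simp [l, hs1 ht]
    let ρ : Path a b :=
      { toFun := fun t => ⟨l t, hlB t⟩
        continuous_toFun := (hlc.continuous.comp continuous_subtype_val).subtype_mk _
        source' := Subtype.ext (hl0 (by norm_num))
        target' := Subtype.ext (hl1 (by norm_num)) }
    have hext (t : ℝ) : (ρ.map hφ).extend t = e.symm (l t) := by
      rcases le_total t 0 with h0 | h0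
      · rw [Path.extend_of_le_zero _ h0, hl0 (by linarith)]
      · rcases le_total 1 t with h1 | h1
        · rw [Path.extend_of_one_le _ h1, hl1 (by linarith)]
        · rw [Path.extend_apply _ ⟨h0, h1⟩]
          rfl
    refine ⟨ρ.map hφ, ⟨?_, ?_, ?_⟩, ?_⟩
    · rw [show ⇑(ρ.map hφ).extend = fun t => e.symm (l t) from funext hext]
      have hsymm : ContMDiffOn (𝓡 n) (𝓡 n) ∞ e.symm e.target := contMDiffOn_chart_symm
      exact hsymm.comp_contMDiff hlc.contMDiff fun t => hB (hlB t)
    · filter_upwards [Iio_mem_nhds (show (0 : ℝ) < 1 / 3 by norm_num)] with t ht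
      rw [hext, hl0 (le_of_lt ht)]
    · filter_upwards [Ioi_mem_nhds (show (2 / 3 : ℝ) < 1 by norm_num)] with t ht
      rw [hext, hl1 (le_of_lt ht)]
    -- Convexity makes the segment homotopic to the given path inside `B`.
    · have : ContractibleSpace B := hc.contractibleSpace ⟨a, a.2⟩
      exact (SimplyConnectedSpace.paths_homotopic ρ τ).map ⟨φ, hφ⟩
  have hcont : Continuous fun t => e (γ t) :=
    e.continuousOn.comp_continuous γ.continuous fun t => (hγ t).1
  let τ : Path (⟨e (γ 0), (hγ 0).2⟩ : B) ⟨e (γ 1), (hγ 1).2⟩ :=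
    { toFun := fun t => ⟨e (γ t), (hγ t).2⟩
      continuous_toFun := hcont.subtype_mk _
      source' := rfl
      target' := rfl }
  have hinv (t : I) : e.symm (e (γ t)) = γ t := e.left_inv (hγ t).1
  have hp : p = φ ⟨e (γ 0), (hγ 0).2⟩ := ((hinv 0).trans γ.source).symm
  have hq : q = φ ⟨e (γ 1), (hγ 1).2⟩ := ((hinv 1).trans γ.target).symm
  have hτ : γ = (τ.map hφ).cast hp hq := Path.ext (funext fun t => (hinv t).symm)
  rw [hτ]
  exact (key τ).cast hp hq

theorem exists_nhds_isSmoothable (x : M) : ∃ U : Set M, IsOpen U ∧ x ∈ U ∧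
    ∀ {p q : M} (γ : Path p q), (∀ t, γ t ∈ U) → IsSmoothable n γ := by
  let e := chartAt (EuclideanSpace ℝ (Fin n)) x
  obtain ⟨r, hr, hB⟩ := Metric.isOpen_iff.1 e.open_target (e x) (mem_chart_target _ x)
  refine ⟨e.source ∩ e ⁻¹' Metric.ball (e x) r, e.isOpen_inter_preimage Metric.isOpen_ball,
    ⟨mem_chart_source _ x, Metric.mem_ball_self hr⟩, fun γ hγ => ?_⟩
  exact isSmoothable_of_convex x hB (convex_ball _ _) γ hγ

/-- Every path in a manifold is homotopic to a smooth path. -/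
theorem isSmoothable {p q : M} (γ : Path p q) : IsSmoothable n γ := by
  choose U hUo hxU hU using fun x : M => exists_nhds_isSmoothable (n := n) x
  -- A Lebesgue subdivision: each piece of `γ` lies in one good neighbourhood, and the initial
  -- pieces are treated by induction.
  obtain ⟨t, ht0, htm, ⟨N, hN⟩, ht⟩ := exists_monotone_Icc_subset_open_cover_unitInterval
    (c := fun x : M => γ ⁻¹' U x) (fun x => (hUo x).preimage γ.continuous)
    (fun s _ => Set.mem_iUnion.2 ⟨γ s, hxU _⟩)
  have key (k : ℕ) : IsSmoothable n (γ.subpath 0 (t k)) := by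
    induction k with
    | zero =>
      rw [ht0, Path.subpath_self]
      exact isSmoothable_refl _
    | succ k ih =>
      obtain ⟨x, hx⟩ := ht k
      have h1 : IsSmoothable n (γ.subpath (t k) (t (k + 1))) := by
        refine hU x _ fun s => ?_
        have h2 : γ.subpath (t k) (t (k + 1)) s ∈ Set.range (γ.subpath (t k) (t (k + 1))) :=
          Set.mem_range_self s
        rw [Path.range_subpath_of_le _ _ _ (htm k.le_succ)] at h2
        obtain ⟨r, hr, hrs⟩ := h2
        rw [← hrs]
        exact hx hr
      exact (ih.trans h1).of_homotopic ⟨Path.Homotopy.subpathTransSubpath γ _ _ _⟩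
  have h := key N
  rw [hN N le_rfl, Path.subpath_zero_one] at h
  exact h.cast γ.source.symm γ.target.symm

end CircleRoot

end SmoothPath

/-! ### Smooth square roots -/

section SquareRoot

open unitInterval Filter Topology

namespace CircleRoot

/-- The winding numbers of a square around loops are even. -/
theorem even_windingNumber_of_eq_sq {X : Type*} [TopologicalSpace X] (f b : C(X, Circle))
    (h : ∀ x, f x = b x ^ 2) {p : X} (γ : Path p p) :
    Even (windingNumber f γ.toContinuousMap) := by
  obtain ⟨θ, hθ⟩ := exists_exp_lift_interval (b.comp γ.toContinuousMap)
  have h1 := windingNumber_loop b γ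
  have h2 := windingNumber_loop f γ
  rw [angleChange_eq b _ θ.continuous hθ] at h1
  -- Twice a lift of `b` along `γ` is a lift of `b²`.
  rw [angleChange_eq f _ (θ := fun t => θ t + θ t) (by fun_prop)
    fun t => by rw [Circle.exp_add, hθ, h, sq]; rfl] at h2
  refine ⟨windingNumber b γ.toContinuousMap, ?_⟩
  have hpi := Real.pi_pos
  have h3 : (windingNumber f γ.toContinuousMap : ℝ) * (2 * Real.pi) =
      ((windingNumber b γ.toContinuousMap + windingNumber b γ.toContinuousMap : ℤ) : ℝ) *
        (2 * Real.pi) := by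
    push_cast
    rw [add_mul, h1, h2]
    ring
  exact_mod_cast mul_right_cancel₀ (by positivity) h3

variable {n : ℕ} {M : Type u} [TopologicalSpace M] [ChartedSpace (EuclideanSpace ℝ (Fin n)) M]

/-- This is the local square root of `f / f x`: the quotient is 1 at `x`, where `arg`, the imaginary
part of `log`, is smooth. -/
theorem contMDiffAt_exp_arg_half {f : M → Circle} (hf : ContMDiff (𝓡 n) (𝓡 1) ∞ f) (x : M) :
    ContMDiffAt (𝓡 n) (𝓡 1) ∞
      (fun y => Circle.exp (Complex.arg ((f y / f x : Circle) : ℂ) / 2)) x := by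
  have h1 : ContMDiffAt (𝓡 n) 𝓘(ℝ, ℂ) ∞ (fun y => ((f y / f x : Circle) : ℂ)) x := by
    have h2 : ContMDiff (𝓡 n) (𝓡 1) ∞ (fun y => f y / f x) := by
      simp only [div_eq_mul_inv]
      exact hf.mul contMDiff_const
    exact (contMDiff_coe_circle.comp h2) x
  have h3 : ContDiffAt ℝ ∞ (fun z : ℂ => Complex.arg z / 2) ((f x / f x : Circle) : ℂ) := by
    have h4 : ContDiffAt ℝ ∞ Complex.log ((f x / f x : Circle) : ℂ) :=
      (Complex.contDiffAt_log (by simp [Complex.one_mem_slitPlane])).restrict_scalars ℝ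
    have h5 : ContDiffAt ℝ ∞ (fun z : ℂ => (Complex.log z).im) ((f x / f x : Circle) : ℂ) :=
      Complex.imCLM.contDiff.contDiffAt.comp _ h4
    simp only [Complex.log_im] at h5
    exact h5.div_const 2
  exact (contMDiff_circleExp (m := ∞) _).comp x
    (ContMDiffAt.comp x (g := fun z : ℂ => Complex.arg z / 2) h3.contMDiffAt h1)

/-- A smooth map to the circle with even winding numbers has a smooth square root. -/
theorem exists_sqrt_of_even_windingNumber {f : M → Circle} (hf : ContMDiff (𝓡 n) (𝓡 1) ∞ f)
    (h : ∀ (p : M) (γ : Path p p), Even (windingNumber ⟨f, hf.continuous⟩ γ.toContinuousMap)) :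
    ∃ b : M → Circle, ContMDiff (𝓡 n) (𝓡 1) ∞ b ∧ ∀ x, f x = b x ^ 2 := by
  have hpi := Real.pi_pos
  let F : C(M, Circle) := ⟨f, hf.continuous⟩
  obtain ⟨u, hu⟩ := ((windingCocycle F).map (Int.castAddHom (ZMod 2))).exists_potential
    fun p γ => (ZMod.intCast_eq_zero_iff_even).2 (h p γ)
  -- Where `arg` jumps by `2π`, its half jumps by `π`; the parity `u` changes there too and
  -- compensates. Neither term need be continuous.
  let b : M → Circle := fun x => Circle.exp (Complex.arg (f x) / 2 + Real.pi * (u x).val)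
  refine ⟨b, fun x => ?_, fun x => ?_⟩
  · have := ChartedSpace.locallyPathConnectedSpace (EuclideanSpace ℝ (Fin n)) M
    let r : M → Circle := fun y => f y / f x
    have hr : Continuous r := hf.continuous.div_const (f x)
    have hW : {y | (r y : ℂ) ∈ Complex.slitPlane} ∈ 𝓝 x := by
      refine (Complex.isOpen_slitPlane.preimage
        (show Continuous fun y => (r y : ℂ) by fun_prop)).mem_nhds ?_
      simp [r, Complex.one_mem_slitPlane]
    -- Within `V` the quotient `f y / f x` stays in the slit plane, so the angle change along a path
    -- in `V` from `x` to `y` is its principal argument.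
    obtain ⟨V, ⟨hV, hVp⟩, hVW⟩ := (path_connected_basis x).mem_iff.1 hW
    have hx : x ∈ V := mem_of_mem_nhds hV
    have hsm : ContMDiffAt (𝓡 n) (𝓡 1) ∞
        (fun y => b x * Circle.exp (Complex.arg (r y) / 2)) x :=
      contMDiffAt_const.mul (contMDiffAt_exp_arg_half hf x)
    refine hsm.congr_of_eventuallyEq ?_
    filter_upwards [hV] with y hy
    obtain ⟨γ, hγ⟩ := hVp.joinedIn x hx y hy
    have hlift : angleChange F γ.toContinuousMap = Complex.arg (r y) := by
      rw [angleChange_eq F γ.toContinuousMap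
        (θ := fun t => Complex.arg (f x) + Complex.arg (r (γ t)))]
      · simp [r]
      · refine continuous_const.add (continuous_iff_continuousAt.2 fun t => ?_)
        exact (Complex.continuousAt_arg (hVW (hγ t))).comp
          (f := fun t => (r (γ t) : ℂ)) (by fun_prop)
      · intro t
        rw [Circle.exp_add, Circle.exp_arg, Circle.exp_arg]
        simp only [r]
        rw [mul_div_cancel]
        rfl
    have hw := windingNumber_spec F γ.toContinuousMap
    have h0 : γ.toContinuousMap 0 = x := γ.source
    have h1 : γ.toContinuousMap 1 = y := γ.target
    rw [hlift, h0, h1] at hw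
    have hpar : ((windingNumber F γ.toContinuousMap : ℤ) : ZMod 2) = u y - u x := hu x y γ
    -- The potential identity lifted to integers; halving `hw` then shows that the two angles
    -- compared differ by `2πk`.
    obtain ⟨k, hk⟩ : ∃ k : ℤ, windingNumber F γ.toContinuousMap + (u x).val - (u y).val = 2 * k := by
      have : ((windingNumber F γ.toContinuousMap + (u x).val - (u y).val : ℤ) : ZMod 2) = 0 := by
        push_cast
        rw [hpar, ZMod.natCast_val, ZMod.natCast_val, ZMod.cast_id, ZMod.cast_id]
        ring
      exact (ZMod.intCast_eq_zero_iff_even.1 this).two_dvd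
    have hk' : (windingNumber F γ.toContinuousMap : ℝ) + (u x).val - (u y).val = 2 * k := by
      exact_mod_cast hk
    change Circle.exp _ = Circle.exp _ * Circle.exp _
    rw [← Circle.exp_add]
    refine Circle.exp_eq_exp.2 ⟨-k, ?_⟩
    have hF (z : M) : F z = f z := rfl
    rw [hF, hF] at hw
    push_cast
    linear_combination (1 / 2 : ℝ) * hw - Real.pi * hk'
  · change f x = (Circle.exp _) ^ 2
    rw [sq, ← Circle.exp_add, show Complex.arg (f x) / 2 + Real.pi * (u x).val +
      (Complex.arg (f x) / 2 + Real.pi * (u x).val) =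
        Complex.arg (f x) + 2 * Real.pi * ((u x).val : ℤ) by push_cast; ring,
      Circle.exp_add, Circle.exp_two_pi_mul_int, mul_one, Circle.exp_arg]

end CircleRoot

end SquareRoot

/-! ### The winding functional -/

section WindingFunctional

namespace CircleRoot

variable {n : ℕ} {M : Type u} [TopologicalSpace M] [ChartedSpace (EuclideanSpace ℝ (Fin n)) M]
  [IsManifold (𝓡 n) ∞ M] {β : M → Circle}

theorem fromPath_mk_eq_iff {p : M} {γ γ' : Path p p} :
    FundamentalGroup.fromPath ⟦γ⟧ = FundamentalGroup.fromPath ⟦γ'⟧ ↔ γ.Homotopic γ' :=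
  Path.Homotopic.Quotient.eq

theorem exists_isC1Path {p : M} (γ : Path p p) :
    ∃ γ' : Path p p, IsC1Path n γ' ∧
      FundamentalGroup.fromPath ⟦γ'⟧ = FundamentalGroup.fromPath ⟦γ⟧ := by
  obtain ⟨γ', hγ', h⟩ := isSmoothable (n := n) γ
  exact ⟨γ', hγ'.isC1Path, fromPath_mk_eq_iff.2 h⟩

/-- The integral is an angle change, which depends only on the homotopy class and is `2π` times an
integer on loops. Hence the choice in `windingFunctional` is immaterial. -/
theorem angularIntegral_eq_windingNumber (hβ : ContMDiff (𝓡 n) (𝓡 1) ∞ β) {p : M} (γ γ' : Path p p)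
    (hγ' : IsC1Path n γ') (h : γ'.Homotopic γ) :
    1 / (2 * Real.pi) * angularIntegral (n := n) β γ' =
      windingNumber ⟨β, hβ.continuous⟩ γ.toContinuousMap := by
  have : IsManifold (𝓡 n) 1 M := IsManifold.of_le (n := ∞) (by exact_mod_cast le_top)
  have hpi := Real.pi_pos
  rw [angularIntegral_eq_angleChange (hβ.of_le (by exact_mod_cast le_top)) γ' hγ',
    show angleChange ⟨β, hβ.continuous⟩ γ'.toContinuousMap = _ from
      (angleCocycle ⟨β, hβ.continuous⟩).homotopic h]
  change 1 / (2 * Real.pi) * angleChange ⟨β, hβ.continuous⟩ γ.toContinuousMap = _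
  rw [← windingNumber_loop]
  field_simp

theorem windingFunctional_fromPath (hβ : ContMDiff (𝓡 n) (𝓡 1) ∞ β) {p : M} (γ : Path p p) :
    windingFunctional n β p (FundamentalGroup.fromPath ⟦γ⟧) =
      windingNumber ⟨β, hβ.continuous⟩ γ.toContinuousMap := by
  have h := exists_isC1Path (n := n) γ
  rw [windingFunctional, dif_pos h]
  exact angularIntegral_eq_windingNumber hβ γ h.choose h.choose_spec.1
    (fromPath_mk_eq_iff.1 h.choose_spec.2)

/-- The floor in `windingModTwo` acts on a number already known to be an integer. -/
theorem windingModTwo_fromPath_eq_zero_iff (hβ : ContMDiff (𝓡 n) (𝓡 1) ∞ β) {p : M}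
    (γ : Path p p) : windingModTwo n β p (FundamentalGroup.fromPath ⟦γ⟧) = 0 ↔
      Even (windingNumber ⟨β, hβ.continuous⟩ γ.toContinuousMap) := by
  rw [windingModTwo, windingFunctional_fromPath hβ, Int.floor_intCast,
    ZMod.intCast_eq_zero_iff_even]

theorem windingModTwo_eq_zero_iff (hβ : ContMDiff (𝓡 n) (𝓡 1) ∞ β) (p : M) :
    windingModTwo n β p = 0 ↔
      ∀ γ : Path p p, Even (windingNumber ⟨β, hβ.continuous⟩ γ.toContinuousMap) := by
  constructor
  · intro h γ
    rw [← windingModTwo_fromPath_eq_zero_iff hβ, h]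
    rfl
  · intro h
    funext c
    obtain ⟨γ, rfl⟩ : ∃ γ : Path p p, FundamentalGroup.fromPath ⟦γ⟧ = c := Quotient.exists_rep c
    exact (windingModTwo_fromPath_eq_zero_iff hβ γ).2 (h γ)

theorem even_of_intCast_mem_span_two_int (k : ℤ) (hk : (k : ℤ) ∈ Ideal.span {(2 : ℤ)}) : Even k :=
  even_iff_two_dvd.2 (Ideal.mem_span_singleton.1 hk)

theorem even_of_intCast_mem_span_two_zmod (k : ℤ)
    (hk : (k : ZMod 2) ∈ Ideal.span {(2 : ZMod 2)}) : Even k := by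
  rw [show (2 : ZMod 2) = 0 from rfl, Ideal.span_singleton_eq_bot.2 rfl] at hk
  exact ZMod.intCast_eq_zero_iff_even.1 hk

end CircleRoot

end WindingFunctional

end

/-! ### The equivalence theorem -/

theorem mainTheorem11 {n : ℕ} {M : Type u} [TopologicalSpace M] [T2Space M]
    [SecondCountableTopology M] [ChartedSpace (EuclideanSpace ℝ (Fin n)) M] [IsManifold (𝓡 n) ∞ M]
    (β : M → Circle) (hβ : ContMDiff (𝓡 n) (𝓡 1) ∞ β) :
    -- the functional `F_{β,p}` is well defined on `π₁(M, p)` and takes integer values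
    (∀ (p : M) (c : FundamentalGroup M p),
      (∃ σ : Path p p, CircleRoot.IsC1Path n σ ∧ FundamentalGroup.fromPath ⟦σ⟧ = c) ∧
      (∀ σ : Path p p, CircleRoot.IsC1Path n σ → FundamentalGroup.fromPath ⟦σ⟧ = c →
        CircleRoot.windingFunctional n β p c =
          1 / (2 * Real.pi) * CircleRoot.angularIntegral (n := n) β σ) ∧
      ∃ k : ℤ, CircleRoot.windingFunctional n β p c = k) ∧
    List.TFAE [
      -- `β` has a smooth square root
      ∃ b : M → Circle, ContMDiff (𝓡 n) (𝓡 1) ∞ b ∧ ∀ x, β x = b x ^ 2,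
      -- `[F_{β,p}] = 0` for all `p`
      ∀ p : M, CircleRoot.windingModTwo n β p = 0,
      -- vanishing on some / every set of loops that generates `H₁(M; ℤ)`
      ∃ S : Set (Σ p : M, Path p p), CircleRoot.GeneratesH1 ℤ S ∧
        ∀ σ ∈ S, CircleRoot.windingModTwo n β σ.1 (FundamentalGroup.fromPath ⟦σ.2⟧) = 0,
      ∀ S : Set (Σ p : M, Path p p), CircleRoot.GeneratesH1 ℤ S →
        ∀ σ ∈ S, CircleRoot.windingModTwo n β σ.1 (FundamentalGroup.fromPath ⟦σ.2⟧) = 0,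
      -- vanishing on some / every set of loops that generates `H₁(M; ℤ₂)`
      ∃ S : Set (Σ p : M, Path p p), CircleRoot.GeneratesH1 (ZMod 2) S ∧
        ∀ σ ∈ S, CircleRoot.windingModTwo n β σ.1 (FundamentalGroup.fromPath ⟦σ.2⟧) = 0,
      ∀ S : Set (Σ p : M, Path p p), CircleRoot.GeneratesH1 (ZMod 2) S →
        ∀ σ ∈ S, CircleRoot.windingModTwo n β σ.1 (FundamentalGroup.fromPath ⟦σ.2⟧) = 0,
      -- `β^* : H¹(U(1); ℤ₂) → H¹(M; ℤ₂)` is zero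
      CircleRoot.cohomologyPullback (ModuleCat.of ℤ (ULift.{u} (ZMod 2)))
        (CircleRoot.toCircleHom ⟨β, hβ.continuous⟩) 1 = 0] := by
  have hpt (p : M) (γ : Path p p) := CircleRoot.windingModTwo_fromPath_eq_zero_iff hβ γ
  constructor
  · intro p c
    obtain ⟨γ, rfl⟩ : ∃ γ : Path p p, FundamentalGroup.fromPath ⟦γ⟧ = c := Quotient.exists_rep c
    refine ⟨CircleRoot.exists_isC1Path γ, fun τ hτ h => ?_, _,
      CircleRoot.windingFunctional_fromPath hβ γ⟩
    rw [CircleRoot.windingFunctional_fromPath hβ,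
      CircleRoot.angularIntegral_eq_windingNumber hβ γ τ hτ (CircleRoot.fromPath_mk_eq_iff.1 h)]
  · have of_generates {R : Type} [CommRing R]
        (hR : ∀ k : ℤ, (k : R) ∈ Ideal.span {(2 : R)} → Even k)
        (h : ∃ S : Set (Σ p : M, Path p p), CircleRoot.GeneratesH1 R S ∧
          ∀ σ ∈ S, CircleRoot.windingModTwo n β σ.1 (FundamentalGroup.fromPath ⟦σ.2⟧) = 0)
        (p : M) : CircleRoot.windingModTwo n β p = 0 := by
      obtain ⟨S, hS, h⟩ := h
      refine (CircleRoot.windingModTwo_eq_zero_iff hβ p).2 fun γ => ?_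
      exact CircleRoot.even_windingNumber_of_generatesH1 hR hS _
        (fun τ hτ => (hpt _ _).1 (h τ hτ)) γ
    tfae_have 1 → 2 := by
      rintro ⟨b, hb, hsq⟩ p
      exact (CircleRoot.windingModTwo_eq_zero_iff hβ p).2 fun γ =>
        CircleRoot.even_windingNumber_of_eq_sq _ ⟨b, hb.continuous⟩ hsq γ
    tfae_have 2 → 1 := fun h => CircleRoot.exists_sqrt_of_even_windingNumber hβ fun p =>
      (CircleRoot.windingModTwo_eq_zero_iff hβ p).1 (h p)
    tfae_have 2 → 4 := fun h S _ τ _ => congrFun (h τ.1) _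
    tfae_have 2 → 6 := fun h S _ τ _ => congrFun (h τ.1) _
    -- The set of all loops generates, so the "every" reading is not vacuous and implies the "some"
    -- reading.
    tfae_have 4 → 3 := fun h =>
      ⟨Set.univ, CircleRoot.generatesH1_univ, h _ CircleRoot.generatesH1_univ⟩
    tfae_have 6 → 5 := fun h =>
      ⟨Set.univ, CircleRoot.generatesH1_univ, h _ CircleRoot.generatesH1_univ⟩
    tfae_have 3 → 2 := of_generates CircleRoot.even_of_intCast_mem_span_two_int
    tfae_have 5 → 2 := of_generates CircleRoot.even_of_intCast_mem_span_two_zmod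
    tfae_have 2 ↔ 7 := (forall_congr' (CircleRoot.windingModTwo_eq_zero_iff hβ)).trans
      (CircleRoot.cohomologyPullback_toCircleHom_eq_zero_iff _).symm
    tfae_finish
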